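/- Let $\mathbb K$ be one of the rings $\mathbb F_p$ ($p$ prime), $\mathbb Q$ or $\mathbb Z$, let $r$ be a natural number, and let $S=\mathbb K[x_1,\dots,x_r]$ with its $\mathbb N^r$-grading $S=\bigoplus_{u\in\mathbb N^r}\mathbb K\,x^u$. Order $\mathbb N^r$ componentwise. An $r$-filtered simplicial complex is an abstract simplicial complex $K$ with subcomplexes $K_u$ ($u\in\mathbb N^r$) such that $K_u\subseteq K_v$ whenever $u\le v$, such that $K=\bigcup_u K_u$, and such that for some $u'$ one has $K_u=K_{u'}$ for all $u\ge u'$; it is finite if $K$ has finitely many simplices. Its $i$-th simplicial homology $H_i(K)$ is the $\mathbb N^r$-graded $S$-module $\bigoplus_{u\in\mathbb N^r}H_i(K_u;\mathbb K)$, where $\mathbb K$ acts componentwise and $x^a$ maps the summand of degree $v$ to that of degree $v+a$ by the map $H_i(K_v;\mathbb K)\to H_i(K_{v+a};\mathbb K)$ induced by the inclusion $K_v\subseteq K_{v+a}$. Theorem. For every finitely generated $\mathbb N^r$-graded $S$-module $M=\bigoplus_{u}M_u$ and every integer $i>0$ there is a finite $r$-filtered simplicial complex $K$ and an isomorphism of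 $S$-modules $e\colon M\to H_i(K)$ that respects the gradings, that is, $e(M_u)=H_i(K_u;\mathbb K)$ for every $u\in\mathbb N^r$. -/

import Mathlib

set_option maxSynthPendingDepth 3

open scoped DirectSum

noncomputable section

/-! ### Simplicial homology of an abstract simplicial complex on totally ordered vertices -/

namespace SimplicialHomology

variable {V : Type*} [LinearOrder V] (R : Type*) [CommRing R]

/-- The boundary operator on formal `R`-combinations of finite vertex sets. If
`s = {v₀ < v₁ < ⋯ < vₙ}` with `n ≥ 1`, then `∂ s = ∑ⱼ (-1)ʲ (s \ {vⱼ})`, where the position `j`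
of `v = vⱼ` is the number of vertices of `s` below `v`. Vertices have boundary zero
(so there are no chains in degree `-1`, and homology is not reduced). -/
def boundary : (Finset V →₀ R) →ₗ[R] (Finset V →₀ R) :=
  Finsupp.lift (Finset V →₀ R) R (Finset V) fun s =>
    if s.card ≤ 1 then 0
    else ∑ v ∈ s, Finsupp.single (s.erase v) ((-1 : R) ^ (s.filter (fun w => w < v)).card)

variable (L L' L'' : PreAbstractSimplicialComplex V) (n : ℕ)

/-- The `n`-simplices of `L`: the faces with `n + 1` vertices. -/
def simplices {V : Type*} (L : PreAbstractSimplicialComplex V) (n : ℕ) : Set (Finset V) :=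
  {s | s ∈ L.faces ∧ s.card = n + 1}

/-- The simplicial chains `Cₙ(L)`, free on the `n`-simplices of `L`. -/
def chains {V : Type*} (L : PreAbstractSimplicialComplex V) (n : ℕ) :
    Submodule R (Finset V →₀ R) := Finsupp.supported R R (simplices L n)

/-- The cycles `Zₙ(L)`. -/
def cycles : Submodule R (Finset V →₀ R) := chains R L n ⊓ LinearMap.ker (boundary R)

/-- The boundaries `Bₙ(L) = ∂ Cₙ₊₁(L)`. -/
def boundaries : Submodule R (Finset V →₀ R) := (chains R L (n + 1)).map (boundary R)

/-- Simplicial homology `Hₙ(L; R) = Zₙ(L) / Bₙ(L)`. -/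
abbrev Homology : Type _ := cycles R L n ⧸ (boundaries R L n).submoduleOf (cycles R L n)

variable {L L' L''}

theorem chains_mono {V : Type*} {L L' : PreAbstractSimplicialComplex V} (h : L ≤ L') : chains R L n ≤ chains R L' n :=
  Finsupp.supported_mono fun _ hs => ⟨h hs.1, hs.2⟩

theorem cycles_mono (h : L ≤ L') : cycles R L n ≤ cycles R L' n :=
  inf_le_inf_right _ (chains_mono R n h)

theorem boundaries_mono (h : L ≤ L') : boundaries R L n ≤ boundaries R L' n :=
  Submodule.map_mono (chains_mono R (n + 1) h)

/-- The map in homology induced by an inclusion of complexes `L ⊆ L'`. -/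
def homologyMap (h : L ≤ L') : Homology R L n →ₗ[R] Homology R L' n :=
  Submodule.mapQ _ _ (Submodule.inclusion (cycles_mono R n h))
    fun _ hx => boundaries_mono R n h hx

end SimplicialHomology

/-! ### Persistence modules and the associated multigraded modules -/

/-- An `r`-parameter persistence module over `R`. The index set `ℕʳ` is `Fin r →₀ ℕ`, with its
componentwise order. -/
structure PersistenceModule (r : ℕ) (R : Type*) [CommRing R] where
  obj : (Fin r →₀ ℕ) → Type*
  [addCommGroup : ∀ u, AddCommGroup (obj u)]
  [module : ∀ u, Module R (obj u)]
  map : ∀ {u v : Fin r →₀ ℕ}, u ≤ v → (obj u →ₗ[R] obj v)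
  map_id : ∀ (u : Fin r →₀ ℕ) (x : obj u), map (le_refl u) x = x
  map_comp : ∀ {u w v : Fin r →₀ ℕ} (h : u ≤ w) (h' : w ≤ v) (x : obj u),
    map h' (map h x) = map (h.trans h') x

namespace PersistenceModule

variable {r : ℕ} {R : Type*} [CommRing R] (P : PersistenceModule r R)

instance (u : Fin r →₀ ℕ) : AddCommGroup (P.obj u) := P.addCommGroup u

instance (u : Fin r →₀ ℕ) : Module R (P.obj u) := P.module u

/-- The direct sum `⨁ᵤ Mᵤ` of a persistence module. -/
def Total : Type _ := ⨁ u, P.obj u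

instance : AddCommGroup P.Total := inferInstanceAs (AddCommGroup (⨁ u, P.obj u))

instance : Module R P.Total := inferInstanceAs (Module R (⨁ u, P.obj u))

/-- The inclusion of the summand `Mᵤ` into `⨁ᵤ Mᵤ`. -/
def incl (u : Fin r →₀ ℕ) : P.obj u →ₗ[R] P.Total :=
  DirectSum.lof R (Fin r →₀ ℕ) (fun u => P.obj u) u

theorem total_hom_ext {N : Type*} [AddCommGroup N] [Module R N] {f g : P.Total →ₗ[R] N}
    (h : ∀ u x, f (P.incl u x) = g (P.incl u x)) : f = g :=
  DirectSum.linearMap_ext R fun u => LinearMap.ext (h u)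

/-- The action of the monomial `x^a` on `⨁ᵤ Mᵤ`: on the summand `Mᵥ` it is the structure map
`Mᵥ → Mᵥ₊ₐ`. -/
def shift (a : Fin r →₀ ℕ) : Module.End R P.Total :=
  DirectSum.toModule R (Fin r →₀ ℕ) P.Total fun v =>
    P.incl (v + a) ∘ₗ P.map (le_add_of_nonneg_right zero_le)

theorem shift_incl (a v : Fin r →₀ ℕ) (x : P.obj v) :
    P.shift a (P.incl v x) = P.incl (v + a) (P.map (le_add_of_nonneg_right zero_le) x) :=
  DirectSum.toModule_lof R v x

theorem incl_map_eq {u v w : Fin r →₀ ℕ} (e : v = w) (h : u ≤ v) (h' : u ≤ w) (x : P.obj u) :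
    P.incl v (P.map h x) = P.incl w (P.map h' x) := by
  subst e; rfl

/-- The action of the monomials as a monoid homomorphism. -/
def shiftHom : Multiplicative (Fin r →₀ ℕ) →* Module.End R P.Total where
  toFun a := P.shift a.toAdd
  map_one' := by
    refine P.total_hom_ext fun u x => ?_
    rw [shift_incl]
    exact (P.incl_map_eq (add_zero u) _ le_rfl x).trans (congrArg _ (P.map_id u x))
  map_mul' a b := by
    refine P.total_hom_ext fun u x => ?_
    rw [Module.End.mul_apply, shift_incl, shift_incl, shift_incl, P.map_comp]
    refine P.incl_map_eq ?_ _ _ x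
    rw [toAdd_mul, add_assoc, add_comm b.toAdd]

/-- The direct sum `⨁ᵤ Mᵤ` of a persistence module is a module over the polynomial ring: scalars
act componentwise and `x^a` acts by the structure maps `Mᵥ → Mᵥ₊ₐ`. -/
instance : Module (MvPolynomial (Fin r) R) P.Total :=
  Module.compHom P.Total
    ((AddMonoidAlgebra.lift R (Module.End R P.Total) (Fin r →₀ ℕ)) P.shiftHom).toRingHom

/-- The homogeneous part of degree `u` of `⨁ᵤ Mᵤ`. -/
def piece (u : Fin r →₀ ℕ) : AddSubgroup P.Total := (P.incl u).toAddMonoidHom.range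

end PersistenceModule

/-- The subgroups `𝓜 u`, `u ∈ ℕʳ`, make the `R[x₁,…,xᵣ]`-module `M` into an `ℕʳ`-graded module:
`M` is their internal direct sum, and the part `R · x^u` of degree `u` of the polynomial ring
maps `𝓜 v` into `𝓜 (u + v)`. -/
structure IsMultigraded {r : ℕ} (R : Type*) [CommRing R] {M : Type*} [AddCommGroup M]
    [Module (MvPolynomial (Fin r) R) M] (𝓜 : (Fin r →₀ ℕ) → AddSubgroup M) : Prop where
  isInternal : DirectSum.IsInternal 𝓜
  smul_mem : ∀ (u v : Fin r →₀ ℕ) (c : R) (m : M),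
    m ∈ 𝓜 v → MvPolynomial.monomial u c • m ∈ 𝓜 (u + v)

/-! ### Multifiltered simplicial complexes -/

/-- An `r`-filtered simplicial complex with vertices in `V`. -/
structure FilteredSimplicialComplex (r : ℕ) (V : Type*) where
  /-- the underlying simplicial complex -/
  complex : PreAbstractSimplicialComplex V
  /-- the subcomplex of degree `u` -/
  filt : (Fin r →₀ ℕ) → PreAbstractSimplicialComplex V
  mono : ∀ {u v : Fin r →₀ ℕ}, u ≤ v → filt u ≤ filt v
  stabilizes : ∃ u' : Fin r →₀ ℕ, ∀ u, u' ≤ u → filt u = filt u'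
  faces_eq_iUnion : complex.faces = ⋃ u, (filt u).faces

namespace FilteredSimplicialComplex

variable {r : ℕ} {V : Type*} (X : FilteredSimplicialComplex r V)

/-- The complex has finitely many simplices. -/
def IsFinite : Prop := X.complex.faces.Finite

/-- The simplicial homology of a multifiltered simplicial complex: the modules `Hᵢ(Kᵤ; R)` with
the maps induced by the inclusions `Kᵤ ⊆ Kᵥ`. -/
def homology [LinearOrder V] (R : Type*) [CommRing R] (i : ℕ) : PersistenceModule r R where
  obj u := SimplicialHomology.Homology R (X.filt u) i
  map h := SimplicialHomology.homologyMap R i (X.mono h)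
  map_id _ x := by
    obtain ⟨x, rfl⟩ := Submodule.Quotient.mk_surjective _ x
    rfl
  map_comp _ _ x := by
    obtain ⟨x, rfl⟩ := Submodule.Quotient.mk_surjective _ x
    rfl

end FilteredSimplicialComplex

end

/-! Suspension is functorial and raises homological degree by one in positive degrees, so it is
enough to realise `M` as a first homology module and then suspend (`Suspension.isHomologyMarking`).

For first homology, choose finitely many homogeneous generators. In degree `u`, `M` is the quotient
of the vectors supported on generators of degree at most `u` by a submodule of relations that grows
with `u`; Hilbert's basis theorem yields finitely many relations generating all of these
(`exists_finset_span_eq`). Over `𝔽_p`, `ℚ` or `ℤ` each relation is, up to a unit, an integer vector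
(`exists_unit_smul_eq_intCast`), hence a word in the generators and their negatives. As in the
presentation complex of a group, each generator gives a loop that appears in its degree, and each
relation gives a disc, glued along its word, that appears in the degree of the relation.

First homology is computed by labelling oriented edges with vectors in `Rᴶ`. Around every triangle
the labels add up to zero or to a relation (`IsCell.label_sum_mem`), so boundaries have labels in
the span of the relations. Conversely, modulo boundaries, the loop through the base point and an
edge depends only on the label of that edge (`determined_of_mem`), so a cycle with label in that
span bounds. This gives `mem_boundaries_iff`; every admissible vector is the label of a cycle by
`exists_chainLabel_eq`. -/

/-! ### From maps on chains to an isomorphism of graded modules -/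

open MvPolynomial in
/-- Linear maps `φ u` on simplicial chains which identify the persistence module of `i`-th homology
groups of `X` with the multigraded module `M = ⨁ᵤ 𝓜 u`. -/
structure IsHomologyMarking {r : ℕ} {R : Type*} [CommRing R] {V : Type*} [LinearOrder V]
    {M : Type*} [AddCommGroup M] [Module (MvPolynomial (Fin r) R) M] [Module R M]
    (X : FilteredSimplicialComplex r V) (i : ℕ) (𝓜 : (Fin r →₀ ℕ) → AddSubgroup M)
    (φ : (Fin r →₀ ℕ) → (Finset V →₀ R) →ₗ[R] M) : Prop where
  mem : ∀ u, ∀ z ∈ SimplicialHomology.cycles R (X.filt u) i, φ u z ∈ 𝓜 u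
  surj : ∀ u, ∀ m ∈ 𝓜 u, ∃ z ∈ SimplicialHomology.cycles R (X.filt u) i, φ u z = m
  eq_zero_iff : ∀ u, ∀ z ∈ SimplicialHomology.cycles R (X.filt u) i,
    φ u z = 0 ↔ z ∈ SimplicialHomology.boundaries R (X.filt u) i
  shift : ∀ u v, u ≤ v → ∀ z ∈ SimplicialHomology.cycles R (X.filt u) i,
    φ v z = monomial (v - u) (1 : R) • φ u z

namespace IsHomologyMarking

open SimplicialHomology MvPolynomial

variable {r : ℕ} {R : Type*} [CommRing R] {V : Type*} [LinearOrder V]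
    {M : Type*} [AddCommGroup M] [Module (MvPolynomial (Fin r) R) M] [Module R M]
    {X : FilteredSimplicialComplex r V} {i : ℕ} {𝓜 : (Fin r →₀ ℕ) → AddSubgroup M}
    {φ : (Fin r →₀ ℕ) → (Finset V →₀ R) →ₗ[R] M}

/-- The map induced by a marking on homology. -/
noncomputable def onHomology (h : IsHomologyMarking X i 𝓜 φ) (u : Fin r →₀ ℕ) :
    (X.homology R i).obj u →ₗ[R] M :=
  Submodule.liftQ _ ((φ u).domRestrict (cycles R (X.filt u) i))
    fun z hz => (h.eq_zero_iff u z z.2).2 hz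

theorem onHomology_mk (h : IsHomologyMarking X i 𝓜 φ) (u : Fin r →₀ ℕ)
    (z : cycles R (X.filt u) i) :
    h.onHomology u (Submodule.Quotient.mk z : Homology R (X.filt u) i) = φ u z := rfl

theorem onHomology_injective (h : IsHomologyMarking X i 𝓜 φ) (u : Fin r →₀ ℕ) :
    Function.Injective (h.onHomology u) := by
  rw [injective_iff_map_eq_zero]
  intro x hx
  obtain ⟨z, rfl⟩ := Submodule.Quotient.mk_surjective _ x
  rw [onHomology_mk, h.eq_zero_iff u z z.2] at hx
  exact (Submodule.Quotient.mk_eq_zero _).2 hx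

theorem onHomology_mem (h : IsHomologyMarking X i 𝓜 φ) (u : Fin r →₀ ℕ)
    (x : (X.homology R i).obj u) : h.onHomology u x ∈ 𝓜 u := by
  obtain ⟨z, rfl⟩ := Submodule.Quotient.mk_surjective _ x
  exact h.mem u z z.2

theorem onHomology_surj (h : IsHomologyMarking X i 𝓜 φ) (u : Fin r →₀ ℕ) {m : M}
    (hm : m ∈ 𝓜 u) : ∃ x, h.onHomology u x = m := by
  obtain ⟨z, hz, rfl⟩ := h.surj u m hm
  exact ⟨(Submodule.Quotient.mk ⟨z, hz⟩ : Homology R (X.filt u) i), rfl⟩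

theorem onHomology_map (h : IsHomologyMarking X i 𝓜 φ) {u v : Fin r →₀ ℕ} (huv : u ≤ v)
    (x : (X.homology R i).obj u) : h.onHomology v ((X.homology R i).map huv x) =
      monomial (v - u) (1 : R) • h.onHomology u x := by
  obtain ⟨z, rfl⟩ := Submodule.Quotient.mk_surjective _ x
  exact h.shift u v huv z z.2

/-- The map induced by a marking on the direct sum of all homology modules. -/
noncomputable def onTotal (h : IsHomologyMarking X i 𝓜 φ) : (X.homology R i).Total →ₗ[R] M :=
  DirectSum.toModule R (Fin r →₀ ℕ) M h.onHomology

theorem onTotal_incl (h : IsHomologyMarking X i 𝓜 φ) (u : Fin r →₀ ℕ)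
    (x : (X.homology R i).obj u) :
    h.onTotal ((X.homology R i).incl u x) = h.onHomology u x :=
  DirectSum.toModule_lof R u x

/-- The map is a direct sum of isomorphisms onto the pieces `𝓜 u`, followed by the summation map `⨁
𝓜 u → M`, which is bijective by internality. -/
theorem onTotal_bijective (h : IsHomologyMarking X i 𝓜 φ) (hM : DirectSum.IsInternal 𝓜) :
    Function.Bijective h.onTotal := by
  let g : ∀ u, (X.homology R i).obj u →+ 𝓜 u := fun u =>
    (h.onHomology u).toAddMonoidHom.codRestrict (𝓜 u) (h.onHomology_mem u)
  have hg : ∀ u, Function.Bijective (g u) := fun u =>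
    ⟨fun x y hxy => h.onHomology_injective u (congrArg Subtype.val hxy), fun m => by
      obtain ⟨x, hx⟩ := h.onHomology_surj u m.2
      exact ⟨x, Subtype.ext hx⟩⟩
  have hmap : Function.Bijective (DirectSum.map g) :=
    ⟨(DirectSum.map_injective g).2 fun u => (hg u).1,
      (DirectSum.map_surjective g).2 fun u => (hg u).2⟩
  have hcomp : (h.onTotal : (X.homology R i).Total → M) =
      DirectSum.coeAddMonoidHom 𝓜 ∘ DirectSum.map g := by
    have : h.onTotal.toAddMonoidHom = (DirectSum.coeAddMonoidHom 𝓜).comp (DirectSum.map g) := by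
      refine DirectSum.addHom_ext fun u x => ?_
      refine (h.onTotal_incl u x).trans ?_
      rw [AddMonoidHom.comp_apply, DirectSum.map_of, DirectSum.coeAddMonoidHom_of]
      rfl
    exact congrArg DFunLike.coe this
  rw [hcomp]
  exact hM.comp hmap

@[elab_as_elim]
theorem total_induction {P : PersistenceModule r R} {p : P.Total → Prop} (x : P.Total)
    (zero : p 0) (incl : ∀ u x, p (P.incl u x)) (add : ∀ x y, p x → p y → p (x + y)) : p x :=
  DirectSum.induction_on x zero incl add

theorem monomial_smul_incl (P : PersistenceModule r R) (a v : Fin r →₀ ℕ) (c : R) (x : P.obj v) :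
    (monomial a c : MvPolynomial (Fin r) R) • P.incl v x =
      c • P.incl (v + a) (P.map (le_add_of_nonneg_right zero_le) x) := by
  change (AddMonoidAlgebra.lift R (Module.End R P.Total) (Fin r →₀ ℕ)) P.shiftHom
    (AddMonoidAlgebra.single a c) (P.incl v x) = _
  rw [AddMonoidAlgebra.lift_single, LinearMap.smul_apply]
  exact congrArg _ (P.shift_incl a v x)

theorem onTotal_smul [IsScalarTower R (MvPolynomial (Fin r) R) M]
    (h : IsHomologyMarking X i 𝓜 φ) (f : MvPolynomial (Fin r) R)
    (x : (X.homology R i).Total) : h.onTotal (f • x) = f • h.onTotal x := by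
  induction f using MvPolynomial.induction_on' with
  | monomial a c =>
    induction x using total_induction with
    | zero => rw [smul_zero, map_zero, smul_zero]
    | incl v x =>
      rw [monomial_smul_incl, map_smul, onTotal_incl, onTotal_incl, onHomology_map,
        add_tsub_cancel_left, ← smul_assoc, smul_monomial, smul_eq_mul, mul_one]
    | add x y hx hy => rw [smul_add, map_add, hx, hy, map_add, smul_add]
  | add p q hp hq => rw [add_smul, map_add, hp, hq, add_smul]

theorem exists_linearEquiv [IsScalarTower R (MvPolynomial (Fin r) R) M]
    (h : IsHomologyMarking X i 𝓜 φ) (hM : DirectSum.IsInternal 𝓜) :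
    ∃ e : M ≃ₗ[MvPolynomial (Fin r) R] (X.homology R i).Total,
      ∀ (u : Fin r →₀ ℕ) (m : M), m ∈ 𝓜 u ↔ e m ∈ (X.homology R i).piece u := by
  let e : (X.homology R i).Total ≃ₗ[MvPolynomial (Fin r) R] M :=
    LinearEquiv.ofBijective
      { toFun := h.onTotal
        map_add' := map_add h.onTotal
        map_smul' := h.onTotal_smul } (h.onTotal_bijective hM)
  refine ⟨e.symm, fun u m => ⟨fun hm => ?_, ?_⟩⟩
  · obtain ⟨x, rfl⟩ := h.onHomology_surj u hm
    exact ⟨x, (e.symm_apply_eq.2 (h.onTotal_incl u x).symm).symm⟩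
  · rintro ⟨x, hx⟩
    have : m = h.onHomology u x :=
      (e.symm_apply_eq.1 hx.symm).trans (h.onTotal_incl u x)
    exact this ▸ h.onHomology_mem u x

end IsHomologyMarking

/-! ### Boundaries of simplices and induction on chains -/

namespace SimplicialHomology

variable {V : Type*} [LinearOrder V] {R : Type*} [CommRing R]

theorem boundary_single_of_card_le {s : Finset V} (hs : s.card ≤ 1) :
    boundary R (Finsupp.single s 1) = 0 := by
  simp [boundary, hs]

theorem boundary_single {s : Finset V} (hs : 1 < s.card) :
    boundary R (Finsupp.single s 1) =
      ∑ v ∈ s, Finsupp.single (s.erase v) ((-1 : R) ^ (s.filter (fun w => w < v)).card) := by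
  simp [boundary, hs.not_ge]

theorem single_mem_chains {V : Type*} {L : PreAbstractSimplicialComplex V} {n : ℕ} {s : Finset V}
    (hs : s ∈ L.faces) (hn : s.card = n + 1) (c : R) : Finsupp.single s c ∈ chains R L n :=
  Finsupp.single_mem_supported R c ⟨hs, hn⟩

@[elab_as_elim]
theorem chains_induction {V : Type*} {L : PreAbstractSimplicialComplex V} {n : ℕ}
    {p : (x : Finset V →₀ R) → x ∈ chains R L n → Prop} {x : Finset V →₀ R}
    (hx : x ∈ chains R L n)
    (single : ∀ (s : Finset V) (hs : s ∈ L.faces) (hn : s.card = n + 1),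
      p (Finsupp.single s 1) (single_mem_chains hs hn 1))
    (zero : p 0 (zero_mem _))
    (add : ∀ x y hx hy, p x hx → p y hy → p (x + y) (add_mem hx hy))
    (smul : ∀ (c : R) x hx, p x hx → p (c • x) (Submodule.smul_mem _ c hx)) : p x hx := by
  suffices h : ∃ hx, p x hx from h.2
  rw [chains, Finsupp.supported_eq_span_single] at hx
  induction hx using Submodule.span_induction with
  | mem x h =>
    obtain ⟨s, hs, rfl⟩ := h
    exact ⟨_, single s hs.1 hs.2⟩
  | zero => exact ⟨_, zero⟩
  | add x y _ _ hx hy => exact ⟨_, add x y _ _ hx.2 hy.2⟩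
  | smul c x _ hx => exact ⟨_, smul c x _ hx.2⟩

end SimplicialHomology

/-! ### Suspensions -/

namespace Suspension

open SimplicialHomology

variable {V : Type*}

/-- The two suspension points. -/
def apex (V : Type*) (b : Bool) : Bool ⊕ₗ V := toLex (Sum.inl b)

/-- The inclusion of the vertices. -/
def vert (V : Type*) : V ↪ Bool ⊕ₗ V := ⟨fun v => toLex (Sum.inr v), fun _ _ h => by simpa using h⟩

theorem vert_ne_apex (v : V) (b : Bool) : vert V v ≠ apex V b :=
  fun h => Sum.inr_ne_inl (toLex.injective h)

theorem apex_ne {b b' : Bool} (h : b ≠ b') : apex V b ≠ apex V b' := by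
  simpa [apex] using h

theorem apex_notMem (s : Finset V) (b : Bool) : apex V b ∉ s.map (vert V) := by
  simp [vert_ne_apex]

/-- The cone over a simplex. -/
def cone (b : Bool) (s : Finset V) : Finset (Bool ⊕ₗ V) :=
  (s.map (vert V)).cons (apex V b) (apex_notMem s b)

theorem apex_mem_cone (b : Bool) (s : Finset V) : apex V b ∈ cone b s := Finset.mem_cons_self _ _

theorem vert_mem_cone {b : Bool} {s : Finset V} {v : V} : vert V v ∈ cone b s ↔ v ∈ s := by
  simp [cone, vert_ne_apex]

theorem card_cone (b : Bool) (s : Finset V) : (cone b s).card = s.card + 1 := by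
  rw [cone, Finset.card_cons, Finset.card_map]

theorem cone_injective (b : Bool) : Function.Injective (cone (V := V) b) := fun s t h => by
  ext v
  rw [← vert_mem_cone (b := b), h, vert_mem_cone]

theorem map_ne_cone (b : Bool) (s t : Finset V) : s.map (vert V) ≠ cone b t := fun h =>
  apex_notMem s b (h ▸ apex_mem_cone b t)

theorem cone_ne_cone {b b' : Bool} (hb : b ≠ b') (s t : Finset V) : cone b s ≠ cone b' t :=
  fun h => by
    have : apex V b ∈ cone b' t := h ▸ apex_mem_cone b s
    simp [cone, apex_ne hb, vert_ne_apex] at this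

theorem cone_erase_apex [DecidableEq (Bool ⊕ₗ V)] (b : Bool) (s : Finset V) :
    (cone b s).erase (apex V b) = s.map (vert V) := by
  rw [cone, Finset.erase_cons]

variable [LinearOrder V]

theorem apex_lt_vert (v : V) (b : Bool) : apex V b < vert V v := Sum.Lex.inl_lt_inr _ _

theorem vert_lt_vert {v w : V} : vert V v < vert V w ↔ v < w := Sum.Lex.inr_lt_inr_iff

theorem cone_erase_vert [DecidableEq (Bool ⊕ₗ V)] (b : Bool) (s : Finset V) (v : V) :
    (cone b s).erase (vert V v) = cone b (s.erase v) := by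
  rw [cone, Finset.erase_cons_of_ne _ (vert_ne_apex v b).symm]
  simp [cone, Finset.map_erase]

theorem exists_eq_of_subset_cone {b : Bool} {s : Finset V} {t : Finset (Bool ⊕ₗ V)}
    (h : t ⊆ cone b s) : ∃ s' ⊆ s, t = s'.map (vert V) ∨ t = cone b s' := by
  have key : ∀ t ⊆ s.map (vert V), ∃ s' ⊆ s, t = s'.map (vert V) := fun t ht => by
    obtain ⟨s', hs', rfl⟩ := Finset.subset_map_iff.1 ht
    exact ⟨s', hs', rfl⟩
  by_cases ha : apex V b ∈ t
  · obtain ⟨s', hs', h'⟩ := key (t.erase (apex V b))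
      (by rw [← cone_erase_apex b]; exact Finset.erase_subset_erase _ h)
    refine ⟨s', hs', Or.inr ?_⟩
    rw [← Finset.insert_erase ha, cone, Finset.cons_eq_insert, h']
  · obtain ⟨s', hs', h'⟩ := key t fun x hx => by
      have := h hx
      rw [cone, Finset.mem_cons] at this
      rcases this with rfl | h
      · exact absurd hx ha
      · exact h
    exact ⟨s', hs', Or.inl h'⟩

/-- The suspension of a simplicial complex. -/
def suspension (L : PreAbstractSimplicialComplex V) : PreAbstractSimplicialComplex (Bool ⊕ₗ V) where
  -- The case `s = ∅` supplies the two suspension points, which are present even if `L` is empty.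
  faces := {t | t.Nonempty ∧ ∃ s : Finset V, (s.Nonempty → s ∈ L.faces) ∧
    (t = s.map (vert V) ∨ ∃ b, t = cone b s)}
  isRelLowerSet_faces := by
    rintro t ⟨ht, s, hs, h⟩
    refine ⟨ht, fun t' (htt : t' ⊆ t) ht' => ⟨ht', ?_⟩⟩
    have key : ∃ b, t' ⊆ cone b s := by
      rcases h with rfl | ⟨b, rfl⟩
      · exact ⟨false, htt.trans (Finset.subset_cons _)⟩
      · exact ⟨b, htt⟩
    obtain ⟨b, hb⟩ := key
    obtain ⟨s', hs', h'⟩ := exists_eq_of_subset_cone hb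
    refine ⟨s', fun hne => ?_, h'.imp_right fun h => ⟨b, h⟩⟩
    exact (L.isRelLowerSet_faces (hs (hne.mono hs'))).2 hs' hne

variable {L : PreAbstractSimplicialComplex V}

theorem map_mem_suspension {s : Finset V} (hs : s ∈ L.faces) :
    s.map (vert V) ∈ (suspension L).faces :=
  ⟨(L.isRelLowerSet_faces hs).1.map, s, fun _ => hs, Or.inl rfl⟩

theorem cone_mem_suspension {s : Finset V} (hs : s ∈ L.faces) (b : Bool) :
    cone b s ∈ (suspension L).faces :=
  ⟨⟨_, apex_mem_cone b s⟩, s, fun _ => hs, Or.inr ⟨b, rfl⟩⟩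

theorem suspension_mono {L L' : PreAbstractSimplicialComplex V} (h : L ≤ L') :
    suspension L ≤ suspension L' :=
  fun _ ⟨ht, s, hs, h'⟩ => ⟨ht, s, fun hne => h (hs hne), h'⟩

theorem finite_suspension (h : L.faces.Finite) : (suspension L).faces.Finite := by
  refine Set.Finite.subset (((h.insert ∅).image (fun s => s.map (vert V))).union
    (((h.insert ∅).image (cone false)).union ((h.insert ∅).image (cone true)))) ?_
  rintro t ⟨-, s, hs, h'⟩
  have hs' : s ∈ insert ∅ L.faces := s.eq_empty_or_nonempty.imp id hs
  rcases h' with rfl | ⟨b, rfl⟩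
  · exact Or.inl ⟨s, hs', rfl⟩
  · cases b
    · exact Or.inr (Or.inl ⟨s, hs', rfl⟩)
    · exact Or.inr (Or.inr ⟨s, hs', rfl⟩)

variable {R : Type*} [CommRing R]

/-- The inclusion of chains. -/
noncomputable def inclChain : (Finset V →₀ R) →ₗ[R] (Finset (Bool ⊕ₗ V) →₀ R) :=
  Finsupp.lmapDomain R R (Finset.map (vert V))

/-- The cone over a chain. -/
noncomputable def coneChain (b : Bool) : (Finset V →₀ R) →ₗ[R] (Finset (Bool ⊕ₗ V) →₀ R) :=
  Finsupp.lmapDomain R R (cone b)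

/-- The link of a suspension point in a chain. -/
noncomputable def link (b : Bool) : (Finset (Bool ⊕ₗ V) →₀ R) →ₗ[R] (Finset V →₀ R) :=
  Finsupp.lcomapDomain (cone b) (cone_injective b)

theorem inclChain_single {V : Type*} (s : Finset V) (c : R) :
    inclChain (Finsupp.single s c) = Finsupp.single (s.map (vert V)) c := by
  simp [inclChain]

theorem coneChain_single {V : Type*} (b : Bool) (s : Finset V) (c : R) :
    coneChain b (Finsupp.single s c) = Finsupp.single (cone b s) c := by
  simp [coneChain]

theorem inclChain_injective {V : Type*} : Function.Injective (inclChain (V := V) (R := R)) :=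
  Finsupp.mapDomain_injective (Finset.map_injective _)

theorem link_apply {V : Type*} (b : Bool) (x : Finset (Bool ⊕ₗ V) →₀ R) (s : Finset V) :
    link b x s = x (cone b s) := rfl

theorem link_inclChain {V : Type*} (b : Bool) (x : Finset V →₀ R) : link b (inclChain x) = 0 := by
  ext s
  rw [link_apply]
  exact Finsupp.mapDomain_of_notMem_range _ _ fun ⟨t, ht⟩ => map_ne_cone b t s ht

theorem link_coneChain {V : Type*} (b : Bool) (x : Finset V →₀ R) : link b (coneChain b x) = x := by
  ext s
  rw [link_apply]
  exact Finsupp.mapDomain_apply (cone_injective b) _ _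

theorem link_coneChain_of_ne {V : Type*} {b b' : Bool} (h : b ≠ b') (x : Finset V →₀ R) :
    link b (coneChain b' x) = 0 := by
  ext s
  rw [link_apply]
  exact Finsupp.mapDomain_of_notMem_range _ _ fun ⟨t, ht⟩ => cone_ne_cone h s t ht.symm

theorem boundary_inclChain (x : Finset V →₀ R) :
    boundary R (inclChain x) = inclChain (boundary R x) := by
  suffices (boundary R).comp inclChain = (inclChain (V := V)).comp (boundary R) from
    LinearMap.congr_fun this x
  refine Finsupp.lhom_ext' fun s => LinearMap.ext_ring ?_
  simp only [LinearMap.comp_apply, Finsupp.lsingle_apply, inclChain_single]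
  rcases le_or_gt s.card 1 with h | h
  · rw [boundary_single_of_card_le h, boundary_single_of_card_le (by rwa [Finset.card_map]),
      map_zero]
  · rw [boundary_single h, boundary_single (by rwa [Finset.card_map]), map_sum, Finset.sum_map]
    refine Finset.sum_congr rfl fun v _ => ?_
    rw [inclChain_single, Finset.map_erase, Finset.filter_map, Finset.card_map]
    congr 4
    ext w
    simp [vert_lt_vert]

/-- The suspension points precede all other vertices, so the apex has position `0` and every other
position moves up by one, whence the minus sign. For `n = 0` this fails: the boundary of the cone
over a vertex also contains the apex, as homology is not reduced. -/
theorem boundary_coneChain {n : ℕ} (hn : 0 < n) (b : Bool) {x : Finset V →₀ R}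
    (hx : x ∈ chains R L n) :
    boundary R (coneChain b x) = inclChain x - coneChain b (boundary R x) := by
  induction hx using chains_induction with
  | single s hs hc =>
    rw [coneChain_single, boundary_single (by rw [card_cone]; omega), boundary_single (by omega)]
    rw [cone, Finset.sum_cons, ← cone, cone_erase_apex, inclChain_single, map_sum, Finset.sum_map,
      sub_eq_add_neg, ← Finset.sum_neg_distrib]
    congr 1
    · rw [Finset.filter_false_of_mem, Finset.card_empty, pow_zero]
      intro w hw
      rw [cone, Finset.mem_cons] at hw
      rcases hw with rfl | hw
      · exact lt_irrefl _
      · obtain ⟨v, -, rfl⟩ := Finset.mem_map.1 hw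
        exact (apex_lt_vert v b).not_gt
    · refine Finset.sum_congr rfl fun v _ => ?_
      rw [cone_erase_vert, coneChain_single, ← Finsupp.single_neg]
      congr 1
      have : (cone b s).filter (fun w => w < vert V v) = cone b (s.filter (fun w => w < v)) := by
        rw [cone, Finset.filter_cons, if_pos (apex_lt_vert v b), cone]
        simp only [Finset.filter_map, Function.comp_def, vert_lt_vert]
      rw [this, card_cone, pow_succ, mul_neg_one]
  | zero => simp
  | add x y _ _ hx hy => simp only [map_add, hx, hy]; abel
  | smul c x _ hx => simp only [map_smul, hx, smul_sub]

theorem coneChain_mem {n : ℕ} {x : Finset V →₀ R} (b : Bool) (hx : x ∈ chains R L n) :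
    coneChain b x ∈ chains R (suspension L) (n + 1) := by
  induction hx using chains_induction with
  | single s hs hc =>
    rw [coneChain_single]
    exact single_mem_chains (cone_mem_suspension hs b) (by rw [card_cone, hc]) _
  | zero => simp
  | add x y _ _ hx hy => rw [map_add]; exact add_mem hx hy
  | smul c x _ hx => rw [map_smul]; exact Submodule.smul_mem _ _ hx

/-- In positive degree every simplex of the suspension lies over a nonempty face of `L`; isolated
suspension points do not occur. -/
theorem exists_eq_of_mem_chains {n : ℕ} {z : Finset (Bool ⊕ₗ V) →₀ R}
    (hz : z ∈ chains R (suspension L) (n + 1)) :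
    ∃ x ∈ chains R L (n + 1), ∃ y ∈ chains R L n, ∃ y' ∈ chains R L n,
      z = inclChain x + coneChain false y + coneChain true y' := by
  induction hz using chains_induction with
  | single t ht hc =>
    obtain ⟨-, s, hs, rfl | ⟨b, rfl⟩⟩ := ht
    · rw [Finset.card_map] at hc
      have hs := hs (Finset.card_pos.1 (by omega))
      exact ⟨Finsupp.single s 1, single_mem_chains hs hc _, 0, zero_mem _, 0, zero_mem _,
        by simp [inclChain_single]⟩
    · rw [card_cone, add_left_inj] at hc
      have hs := hs (Finset.card_pos.1 (by omega))
      have := single_mem_chains hs hc (1 : R)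
      cases b
      · exact ⟨0, zero_mem _, Finsupp.single s 1, this, 0, zero_mem _, by simp [coneChain_single]⟩
      · exact ⟨0, zero_mem _, 0, zero_mem _, Finsupp.single s 1, this, by simp [coneChain_single]⟩
  | zero => exact ⟨0, zero_mem _, 0, zero_mem _, 0, zero_mem _, by simp⟩
  | add z z' _ _ h h' =>
    obtain ⟨x, hx, y, hy, w, hw, rfl⟩ := h
    obtain ⟨x', hx', y', hy', w', hw', rfl⟩ := h'
    refine ⟨x + x', add_mem hx hx', y + y', add_mem hy hy', w + w', add_mem hw hw', ?_⟩
    simp only [map_add]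
    abel
  | smul c z _ h =>
    obtain ⟨x, hx, y, hy, w, hw, rfl⟩ := h
    refine ⟨c • x, Submodule.smul_mem _ _ hx, c • y, Submodule.smul_mem _ _ hy, c • w,
      Submodule.smul_mem _ _ hw, ?_⟩
    simp only [map_smul, smul_add]

theorem exists_eq_of_mem_cycles {n : ℕ} (hn : 0 < n) {z : Finset (Bool ⊕ₗ V) →₀ R}
    (hz : z ∈ cycles R (suspension L) (n + 1)) :
    ∃ x ∈ chains R L (n + 1), ∃ y ∈ cycles R L n,
      z = inclChain x + coneChain false y + coneChain true (- boundary R x - y) := by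
  obtain ⟨x, hx, y, hy, y', hy', rfl⟩ := exists_eq_of_mem_chains hz.1
  have hb : boundary R (inclChain x + coneChain false y + coneChain true y') = 0 := hz.2
  rw [map_add, map_add, boundary_inclChain, boundary_coneChain hn _ hy,
    boundary_coneChain hn _ hy'] at hb
  -- The coefficients at the two kinds of cones show that `y` and `y'` are cycles; what remains of
  -- `hb` is `∂x + y + y' = 0`.
  have h1 := congrArg (link false) hb
  have h2 := congrArg (link true) hb
  simp only [map_add, map_sub, link_inclChain, link_coneChain, link_coneChain_of_ne (b := false)
    (b' := true) (by simp), link_coneChain_of_ne (b := true) (b' := false) (by simp), map_zero,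
    zero_add, sub_zero, add_zero, zero_sub, neg_eq_zero] at h1 h2
  rw [h1, h2, map_zero, map_zero, sub_zero, sub_zero, ← map_add, ← map_add,
    map_eq_zero_iff _ inclChain_injective] at hb
  have : y' = - boundary R x - y := by
    rw [add_comm] at hb
    rw [eq_neg_of_add_eq_zero_left hb]
    abel
  exact ⟨x, hx, y, ⟨hy, h1⟩, by rw [this]⟩

theorem link_mem_cycles {n : ℕ} (hn : 0 < n) {z : Finset (Bool ⊕ₗ V) →₀ R}
    (hz : z ∈ cycles R (suspension L) (n + 1)) : link false z ∈ cycles R L n := by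
  obtain ⟨x, hx, y, hy, rfl⟩ := exists_eq_of_mem_cycles hn hz
  rw [map_add, map_add, link_inclChain, link_coneChain, link_coneChain_of_ne (by simp)]
  simpa using hy

/-- The difference of the two cones over a cycle is a cycle, since both cones have boundary `y`. -/
theorem exists_link_eq {n : ℕ} (hn : 0 < n) {y : Finset V →₀ R} (hy : y ∈ cycles R L n) :
    ∃ z ∈ cycles R (suspension L) (n + 1), link false z = y := by
  refine ⟨coneChain false y - coneChain true y,
    ⟨sub_mem (coneChain_mem _ hy.1) (coneChain_mem _ hy.1), ?_⟩, ?_⟩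
  · have : boundary R y = 0 := hy.2
    change boundary R _ = 0
    rw [map_sub, boundary_coneChain hn _ hy.1, boundary_coneChain hn _ hy.1, this]
    simp
  · rw [map_sub, link_coneChain, link_coneChain_of_ne (by simp), sub_zero]

theorem link_mem_boundaries_iff {n : ℕ} (hn : 0 < n) {z : Finset (Bool ⊕ₗ V) →₀ R}
    (hz : z ∈ cycles R (suspension L) (n + 1)) :
    link false z ∈ boundaries R L n ↔ z ∈ boundaries R (suspension L) (n + 1) := by
  constructor
  · intro h
    obtain ⟨x, hx, y, hy, rfl⟩ := exists_eq_of_mem_cycles hn hz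
    rw [map_add, map_add, link_inclChain, link_coneChain, link_coneChain_of_ne (by simp), zero_add,
      add_zero] at h
    obtain ⟨w, hw, rfl⟩ := h
    -- With `y = ∂w`, the `false` cone over `∂w` must come from `-coneChain false w`; the `true`
    -- cone restores the part in `L`, because `(x + w) - w = x`.
    refine ⟨coneChain true (x + w) - coneChain false w, sub_mem (coneChain_mem _ (add_mem hx hw))
      (coneChain_mem _ hw), ?_⟩
    rw [map_sub, boundary_coneChain (n := n + 1) (by omega) _ (add_mem hx hw),
      boundary_coneChain (n := n + 1) (by omega) _ hw]
    simp only [map_add, map_sub, map_neg]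
    abel
  · rintro ⟨w, hw, rfl⟩
    obtain ⟨x, hx, y, hy, y', hy', rfl⟩ := exists_eq_of_mem_chains hw
    -- Taking links at the apex anticommutes with the boundary, hence the sign.
    refine ⟨-y, neg_mem hy, ?_⟩
    rw [map_add (boundary R), map_add (boundary R), boundary_inclChain,
      boundary_coneChain (n := n + 1) (by omega) _ hy,
      boundary_coneChain (n := n + 1) (by omega) _ hy']
    simp [link_inclChain, link_coneChain, link_coneChain_of_ne (b := false) (b' := true)]

/-- The suspension of a multifiltered simplicial complex. -/
def filteredSuspension {r : ℕ} (X : FilteredSimplicialComplex r V) :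
    FilteredSimplicialComplex r (Bool ⊕ₗ V) where
  complex := suspension X.complex
  filt u := suspension (X.filt u)
  mono h := suspension_mono (X.mono h)
  stabilizes := by
    obtain ⟨u', hu⟩ := X.stabilizes
    exact ⟨u', fun u h => by rw [hu u h]⟩
  faces_eq_iUnion := by
    ext t
    rw [Set.mem_iUnion]
    constructor
    · rintro ⟨ht, s, hs, h⟩
      rcases s.eq_empty_or_nonempty with rfl | hne
      -- A suspension point lies in every degree, so degree `0` serves.
      · exact ⟨0, ht, ∅, fun h => absurd h (by simp), h⟩
      · have := hs hne
        rw [X.faces_eq_iUnion, Set.mem_iUnion] at this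
        obtain ⟨u, hu⟩ := this
        exact ⟨u, ht, s, fun _ => hu, h⟩
    · rintro ⟨u, ht, s, hs, h⟩
      refine ⟨ht, s, fun hne => ?_, h⟩
      rw [X.faces_eq_iUnion]
      exact Set.mem_iUnion.2 ⟨u, hs hne⟩

/-- Taking the link at one suspension point identifies cycles modulo boundaries one degree lower. It
is a single map on chains, independent of `u`, so compatibility with the structure maps is
inherited. -/
theorem isHomologyMarking {r : ℕ} {M : Type*} [AddCommGroup M]
    [Module (MvPolynomial (Fin r) R) M] [Module R M] {X : FilteredSimplicialComplex r V} {n : ℕ}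
    (hn : 0 < n) {𝓜 : (Fin r →₀ ℕ) → AddSubgroup M}
    {φ : (Fin r →₀ ℕ) → (Finset V →₀ R) →ₗ[R] M} (h : IsHomologyMarking X n 𝓜 φ) :
    IsHomologyMarking (filteredSuspension X) (n + 1) 𝓜 (fun u => φ u ∘ₗ link false) where
  mem u _ hz := h.mem u _ (link_mem_cycles hn hz)
  surj u m hm := by
    obtain ⟨y, hy, rfl⟩ := h.surj u m hm
    obtain ⟨z, hz, rfl⟩ := exists_link_eq hn hy
    exact ⟨z, hz, rfl⟩
  eq_zero_iff u _ hz :=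
    (h.eq_zero_iff u _ (link_mem_cycles hn hz)).trans (link_mem_boundaries_iff hn hz)
  shift u v huv _ hz := h.shift u v huv _ (link_mem_cycles hn hz)

end Suspension

/-! ### Oriented edges and labels -/

namespace SimplicialHomology

section OrientedEdges

variable {V : Type*} [LinearOrder V] (R : Type*) [CommRing R]

/-- The oriented edge from `a` to `b`. -/
noncomputable def orientedEdge (a b : V) : Finset V →₀ R :=
  if a < b then Finsupp.single {a, b} 1 else if b < a then -Finsupp.single {a, b} 1 else 0

/-- The closed path through three vertices. -/
noncomputable def orientedTriangle (a b c : V) : Finset V →₀ R :=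
  orientedEdge R a b + orientedEdge R b c + orientedEdge R c a

variable {R}

theorem orientedEdge_of_lt {a b : V} (h : a < b) :
    orientedEdge R a b = Finsupp.single {a, b} 1 := if_pos h

theorem orientedEdge_self (a : V) : orientedEdge R a a = 0 := by simp [orientedEdge]

theorem orientedEdge_symm (a b : V) : orientedEdge R b a = -orientedEdge R a b := by
  rcases lt_trichotomy a b with h | rfl | h
  · simp [orientedEdge, h, h.not_gt, Finset.pair_comm]
  · simp [orientedEdge_self]
  · simp [orientedEdge, h, h.not_gt, Finset.pair_comm]

theorem orientedTriangle_rotate (a b c : V) :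
    orientedTriangle R b c a = orientedTriangle R a b c := by
  simp only [orientedTriangle]; abel

theorem orientedTriangle_swap (a b c : V) :
    orientedTriangle R b a c = -orientedTriangle R a b c := by
  simp only [orientedTriangle]
  rw [orientedEdge_symm a b, orientedEdge_symm c a, orientedEdge_symm b c]
  abel

theorem orientedTriangle_swap_right (a b c : V) :
    orientedTriangle R a c b = -orientedTriangle R a b c := by
  rw [← orientedTriangle_rotate a c b, orientedTriangle_swap b c a, orientedTriangle_rotate]

theorem orientedTriangle_self (a b : V) : orientedTriangle R a a b = 0 := by
  simp only [orientedTriangle]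
  rw [orientedEdge_self, orientedEdge_symm a b]
  abel

/-- The edges at `d` cancel in pairs. With `d` the base point, a filled triangle becomes a linear
relation among the base loops of its three edges. -/
theorem orientedTriangle_cocycle (a b c d : V) :
    orientedTriangle R a b d + orientedTriangle R b c d + orientedTriangle R c a d =
      orientedTriangle R a b c := by
  simp only [orientedTriangle]
  rw [orientedEdge_symm d a, orientedEdge_symm d b, orientedEdge_symm d c]
  abel

theorem boundary_orientedEdge (a b : V) :
    boundary R (orientedEdge R a b) = Finsupp.single {b} 1 - Finsupp.single {a} 1 := by
  have key : ∀ a b : V, a < b →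
      boundary R (orientedEdge R a b) = Finsupp.single {b} 1 - Finsupp.single {a} 1 := by
    intro a b h
    have h1 : ({a, b} : Finset V).erase a = {b} := by
      ext x; simp only [Finset.mem_erase, Finset.mem_insert, Finset.mem_singleton]; grind
    have h2 : ({a, b} : Finset V).erase b = {a} := by
      ext x; simp only [Finset.mem_erase, Finset.mem_insert, Finset.mem_singleton]; grind
    rw [orientedEdge_of_lt h, boundary_single (by rw [Finset.card_pair h.ne]; omega),
      Finset.sum_pair h.ne, h1, h2]
    simp [Finset.filter_insert, Finset.filter_singleton, h, h.not_gt, sub_eq_add_neg]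
  rcases lt_trichotomy a b with h | rfl | h
  · exact key a b h
  · rw [orientedEdge_self, map_zero, sub_self]
  · rw [orientedEdge_symm b a, map_neg, key b a h, neg_sub]

theorem boundary_triangle {a b c : V} (hab : a < b) (hbc : b < c) :
    boundary R (Finsupp.single {a, b, c} 1) = orientedTriangle R a b c := by
  have hac := hab.trans hbc
  have h1 : ({a, b, c} : Finset V).erase a = {b, c} := by
    ext x; simp only [Finset.mem_erase, Finset.mem_insert, Finset.mem_singleton]; grind
  have h2 : ({a, b, c} : Finset V).erase b = {a, c} := by
    ext x; simp only [Finset.mem_erase, Finset.mem_insert, Finset.mem_singleton]; grind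
  have h3 : ({a, b, c} : Finset V).erase c = {a, b} := by
    ext x; simp only [Finset.mem_erase, Finset.mem_insert, Finset.mem_singleton]; grind
  have hcard : ({a, b, c} : Finset V).card = 3 :=
    Finset.card_eq_three.2 ⟨a, b, c, hab.ne, hac.ne, hbc.ne, rfl⟩
  rw [boundary_single (by omega), Finset.sum_insert (by simp [hab.ne, hac.ne]),
    Finset.sum_pair hbc.ne, h1, h2, h3, orientedTriangle, orientedEdge_symm a c,
    orientedEdge_of_lt hab, orientedEdge_of_lt hbc, orientedEdge_of_lt hac]
  simp [Finset.filter_insert, Finset.filter_singleton, hab, hbc, hac, hab.not_gt, hbc.not_gt,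
    hac.not_gt, hab.ne]
  abel

variable {L : PreAbstractSimplicialComplex V}

/-- Sorting the vertices changes the path only by a sign, and a path with a repeated vertex
vanishes, so neither order nor distinctness is needed. -/
theorem orientedTriangle_mem_boundaries {a b c : V} (h : {a, b, c} ∈ L.faces) :
    orientedTriangle R a b c ∈ boundaries R L 1 := by
  have key : ∀ a b c : V, a < b → b < c → {a, b, c} ∈ L.faces →
      orientedTriangle R a b c ∈ boundaries R L 1 := fun a b c hab hbc h =>
    ⟨Finsupp.single {a, b, c} 1, single_mem_chains h
      (Finset.card_eq_three.2 ⟨a, b, c, hab.ne, (hab.trans hbc).ne, hbc.ne, rfl⟩) _,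
      boundary_triangle hab hbc⟩
  have key' : ∀ a b c : V, a < b → {a, b, c} ∈ L.faces →
      orientedTriangle R a b c ∈ boundaries R L 1 := by
    intro a b c hab h
    rcases lt_trichotomy b c with hbc | rfl | hbc
    · exact key a b c hab hbc h
    · rw [← orientedTriangle_rotate, orientedTriangle_self]
      exact zero_mem _
    · rw [← neg_mem_iff, ← orientedTriangle_swap_right]
      rcases lt_trichotomy a c with hac | rfl | hac
      · exact key a c b hac hbc (by rwa [Finset.pair_comm])
      · rw [orientedTriangle_self]
        exact zero_mem _
      · rw [← neg_mem_iff, ← orientedTriangle_swap]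
        exact key c a b hac hab (by rwa [Finset.insert_comm, Finset.pair_comm])
  rcases lt_trichotomy a b with hab | rfl | hab
  · exact key' a b c hab h
  · rw [orientedTriangle_self]
    exact zero_mem _
  · rw [← neg_mem_iff, ← orientedTriangle_swap]
    exact key' b a c hab (by rwa [Finset.insert_comm])

section Labels

variable {A : Type*} [AddCommGroup A] [Module R A] (c : V → V → A)

/-- The linear map on chains whose value on an edge `{a < b}` is the label `c a b`. -/
noncomputable def labelMap : (Finset V →₀ R) →ₗ[R] A :=
  Finsupp.lift A R (Finset V) fun s => if h : s.Nonempty then c (s.min' h) (s.max' h) else 0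

theorem labelMap_pair {a b : V} (h : a < b) :
    labelMap (R := R) c (Finsupp.single {a, b} 1) = c a b := by
  simp [labelMap, h.le]

variable {c} (hc : ∀ a b, c b a = -c a b) (hc' : ∀ a, c a a = 0)

include hc hc' in
theorem labelMap_orientedEdge (a b : V) : labelMap c (orientedEdge R a b) = c a b := by
  rcases lt_trichotomy a b with h | rfl | h
  · rw [orientedEdge_of_lt h, labelMap_pair c h]
  · rw [orientedEdge_self, map_zero, hc']
  · rw [orientedEdge_symm b a, orientedEdge_of_lt h, map_neg, labelMap_pair c h, ← hc]

theorem exists_lt_of_card_eq_two {s : Finset V} (h : s.card = 2) : ∃ a b, a < b ∧ s = {a, b} := by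
  obtain ⟨a, b, hab, rfl⟩ := Finset.card_eq_two.1 h
  rcases hab.lt_or_gt with h | h
  · exact ⟨a, b, h, rfl⟩
  · exact ⟨b, a, h, Finset.pair_comm _ _⟩

theorem exists_lt_of_card_eq_three {s : Finset V} (h : s.card = 3) :
    ∃ a b c, a < b ∧ b < c ∧ s = {a, b, c} := by
  have hne : s.Nonempty := Finset.card_pos.1 (by omega)
  obtain ⟨b, c, hbc, hs⟩ := exists_lt_of_card_eq_two (s := s.erase (s.min' hne))
    (by rw [Finset.card_erase_of_mem (s.min'_mem hne), h])
  refine ⟨s.min' hne, b, c, ?_, hbc, ?_⟩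
  · exact Finset.min'_lt_of_mem_erase_min' _ _ (hs ▸ by simp)
  · rw [← hs, Finset.insert_erase (s.min'_mem hne)]

include hc hc' in
/-- A label map sends boundaries of `2`-chains into `N` if it does so for triangles. -/
theorem labelMap_mem_of_mem_boundaries {N : Submodule R A}
    (h : ∀ a b d, a < b → b < d → {a, b, d} ∈ L.faces → c a b + c b d + c d a ∈ N)
    {z : Finset V →₀ R} (hz : z ∈ boundaries R L 1) : labelMap c z ∈ N := by
  obtain ⟨x, hx, rfl⟩ := hz
  induction hx using chains_induction with
  | single s hs hn =>
    obtain ⟨a, b, d, hab, hbd, rfl⟩ := exists_lt_of_card_eq_three hn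
    rw [boundary_triangle hab hbd, orientedTriangle, map_add, map_add]
    simp only [labelMap_orientedEdge hc hc']
    exact h a b d hab hbd hs
  | zero => simp
  | add x y _ _ hx hy => rw [map_add, map_add]; exact add_mem hx hy
  | smul r x _ hx => rw [map_smul, map_smul]; exact Submodule.smul_mem _ _ hx

theorem labelMap_mem_of_mem_chains {N : Submodule R A}
    (h : ∀ a b, a < b → {a, b} ∈ L.faces → c a b ∈ N)
    {z : Finset V →₀ R} (hz : z ∈ chains R L 1) : labelMap c z ∈ N := by
  induction hz using chains_induction with
  | single s hs hn =>
    obtain ⟨a, b, hab, rfl⟩ := exists_lt_of_card_eq_two hn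
    rw [labelMap_pair c hab]
    exact h a b hab hs
  | zero => simp
  | add x y _ _ hx hy => rw [map_add]; exact add_mem hx hy
  | smul r x _ hx => rw [map_smul]; exact Submodule.smul_mem _ _ hx

/-- If the class modulo boundaries of the closed path through an edge and the base point `v₀` is
determined by the label of the edge, then so is the class of every cycle. -/
theorem mk_eq_of_mem_cycles (v₀ : V) (ψ : A →ₗ[R] (Finset V →₀ R) ⧸ boundaries R L 1)
    (h : ∀ a b, a < b → {a, b} ∈ L.faces →
      (boundaries R L 1).mkQ (orientedTriangle R a b v₀) = ψ (c a b))
    {z : Finset V →₀ R} (hz : z ∈ cycles R L 1) :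
    (boundaries R L 1).mkQ z = ψ (labelMap c z) := by
  -- On vertices `D` is the edge to `v₀`, so `x + D (∂x)` completes each edge of `x` to its closed
  -- path through `v₀`. The correction vanishes on cycles.
  let D : (Finset V →₀ R) →ₗ[R] (Finset V →₀ R) :=
    Finsupp.lift _ R (Finset V) fun s => ∑ v ∈ s, orientedEdge R v v₀
  have hD : ∀ v, D (Finsupp.single {v} 1) = orientedEdge R v v₀ := fun v => by simp [D]
  have key : ∀ x ∈ chains R L 1,
      (boundaries R L 1).mkQ (x + D (boundary R x)) = ψ (labelMap c x) := by
    intro x hx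
    induction hx using chains_induction with
    | single s hs hn =>
      obtain ⟨a, b, hab, rfl⟩ := exists_lt_of_card_eq_two hn
      rw [labelMap_pair c hab, ← h a b hab hs, ← orientedEdge_of_lt hab, boundary_orientedEdge,
        orientedTriangle, orientedEdge_symm a v₀, map_sub, hD, hD, sub_eq_add_neg, add_assoc]
    | zero => simp
    | add x y _ _ hx hy => simp only [map_add] at hx hy ⊢; rw [← hx, ← hy]; abel
    | smul r x _ hx => simp only [map_smul, ← smul_add, hx]
  rw [← key z hz.1, show boundary R z = 0 from hz.2, map_zero, add_zero]

theorem orientedEdge_mem_chains {a b : V} (h : {a, b} ∈ L.faces) :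
    orientedEdge R a b ∈ chains R L 1 := by
  rcases lt_trichotomy a b with hab | rfl | hab
  · rw [orientedEdge_of_lt hab]
    exact single_mem_chains h (Finset.card_pair hab.ne) _
  · rw [orientedEdge_self]
    exact zero_mem _
  · rw [orientedEdge_symm b a, orientedEdge_of_lt hab, Finset.pair_comm]
    exact neg_mem (single_mem_chains h (Finset.card_pair hab.ne') _)

theorem orientedTriangle_mem_cycles {a b d : V} (hab : {a, b} ∈ L.faces) (hbd : {b, d} ∈ L.faces)
    (hda : {d, a} ∈ L.faces) : orientedTriangle R a b d ∈ cycles R L 1 := by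
  refine ⟨add_mem (add_mem (orientedEdge_mem_chains hab) (orientedEdge_mem_chains hbd))
    (orientedEdge_mem_chains hda), ?_⟩
  change boundary R _ = 0
  simp only [orientedTriangle, map_add, boundary_orientedEdge]
  abel

end Labels

end OrientedEdges

end SimplicialHomology

/-! ### The filtered complex of a presentation -/

/-- The vectors of `Rᴶ` supported on the indices of degree at most `u`. -/
def supportedLE {r : ℕ} {J : Type} (d : J → (Fin r →₀ ℕ)) (R : Type*) [CommRing R]
    (u : Fin r →₀ ℕ) : Submodule R (J → R) where
  carrier := {q | ∀ j, q j ≠ 0 → d j ≤ u}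
  zero_mem' j h := absurd rfl h
  add_mem' {p q} hp hq j h := by
    by_cases hj : p j = 0
    · exact hq j fun h' => h (by simp [hj, h'])
    · exact hp j hj
  smul_mem' c q hq j h := hq j fun h' => h (by simp [h'])

/-- A presentation by generators `j : J` of degree `deg j` and relations `k : K` of degree
`relDeg k`. A relation is a signed sum of generators, written as a list of letters; the letter
`(j, true)` stands for `j` and `(j, false)` for `-j`. -/
structure SignedPresentation (r : ℕ) (J K : Type) where
  deg : J → (Fin r →₀ ℕ)
  relDeg : K → (Fin r →₀ ℕ)
  word : K → List (J × Bool)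
  deg_le : ∀ k, ∀ l ∈ word k, deg l.1 ≤ relDeg k

namespace SignedPresentation

open SimplicialHomology

/-- The vertices of the complex of a presentation. -/
inductive Vertex (J K : Type)
  | base
  | gen (j : J) (b : Bool)
  | mid (k : K) (t : ℕ) (j : J) (b : Bool)
  | path (k : K) (t : ℕ)
  | hub (k : K)

open Vertex

variable {r : ℕ} {J K : Type} (P : SignedPresentation r J K)

/-- The vertices which occur. -/
inductive IsVertex : Vertex J K → Prop
  | base : IsVertex base
  | gen (j : J) (b : Bool) : IsVertex (gen j b)
  | mid {k : K} {t : ℕ} {j : J} {b : Bool} (h : (P.word k)[t]? = some (j, b)) :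
      IsVertex (mid k t j b)
  | path {k : K} {t : ℕ} (h : t ≤ (P.word k).length) : IsVertex (path k t)
  | hub (k : K) : IsVertex (hub k)

/-- The vertices of a collection of simplices which generates the complex of degree `u`. The loop
`base`, `gen j false`, `gen j true` represents the generator `j`. The disc spanned by `hub k` and
`path k t` represents the relation `k`; the triangles at `mid k t j b` form a strip which joins the
edge from `path k t` to `path k (t + 1)` to the edge from `gen j (!b)` to `gen j b`. All remaining
loops are filled by triangles at `base`. -/
inductive IsCell (u : Fin r →₀ ℕ) : Vertex J K → Vertex J K → Vertex J K → Prop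
  -- A repeated vertex encodes an edge. Spokes carry no degree condition, so every complex has all
  -- vertices and is connected.
  | spoke {v} (h : P.IsVertex v) : IsCell u base base v
  | gen {j} (h : P.deg j ≤ u) : IsCell u (gen j false) (gen j false) (gen j true)
  | base_src {k t j b} (h : P.relDeg k ≤ u) (hl : (P.word k)[t]? = some (j, b)) :
      IsCell u base (gen j (!b)) (mid k t j b)
  | base_mid {k t j b} (h : P.relDeg k ≤ u) (hl : (P.word k)[t]? = some (j, b)) :
      IsCell u base (mid k t j b) (path k t)
  | base_tgt {k t j b} (h : P.relDeg k ≤ u) (hl : (P.word k)[t]? = some (j, b)) :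
      IsCell u base (gen j b) (path k (t + 1))
  | mid_gen {k t j b} (h : P.relDeg k ≤ u) (hl : (P.word k)[t]? = some (j, b)) :
      IsCell u (mid k t j b) (gen j (!b)) (gen j b)
  | mid_tgt {k t j b} (h : P.relDeg k ≤ u) (hl : (P.word k)[t]? = some (j, b)) :
      IsCell u (mid k t j b) (gen j b) (path k (t + 1))
  | mid_path {k t j b} (h : P.relDeg k ≤ u) (hl : (P.word k)[t]? = some (j, b)) :
      IsCell u (mid k t j b) (path k t) (path k (t + 1))
  -- The disc needs a centre other than `base`: triangles from `base` over the edges of the path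
  -- would kill each letter separately. Only the two ends of the path are tied to `base` through the
  -- hub.
  | hub_path {k t} (h : P.relDeg k ≤ u) (hl : t < (P.word k).length) :
      IsCell u (hub k) (path k t) (path k (t + 1))
  | base_first {k} (h : P.relDeg k ≤ u) : IsCell u base (hub k) (path k 0)
  | base_last {k} (h : P.relDeg k ≤ u) : IsCell u base (hub k) (path k (P.word k).length)

variable {P} in
theorem IsCell.isVertex {u : Fin r →₀ ℕ} {a b c : Vertex J K} (h : P.IsCell u a b c) :
    P.IsVertex a ∧ P.IsVertex b ∧ P.IsVertex c := by
  have lt {k t j b} (h : (P.word k)[t]? = some (j, b)) : t < (P.word k).length :=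
    (List.getElem?_eq_some_iff.1 h).1
  cases h with
  | spoke h => exact ⟨.base, .base, h⟩
  | gen => exact ⟨.gen _ _, .gen _ _, .gen _ _⟩
  | base_src _ hl => exact ⟨.base, .gen _ _, .mid hl⟩
  | base_mid _ hl => exact ⟨.base, .mid hl, .path (lt hl).le⟩
  | base_tgt _ hl => exact ⟨.base, .gen _ _, .path (lt hl)⟩
  | mid_gen _ hl => exact ⟨.mid hl, .gen _ _, .gen _ _⟩
  | mid_tgt _ hl => exact ⟨.mid hl, .gen _ _, .path (lt hl)⟩
  | mid_path _ hl => exact ⟨.mid hl, .path (lt hl).le, .path (lt hl)⟩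
  | hub_path _ hl => exact ⟨.hub _, .path hl.le, .path hl⟩
  | base_first => exact ⟨.base, .hub _, .path (Nat.zero_le _)⟩
  | base_last => exact ⟨.base, .hub _, .path le_rfl⟩

variable {P} in
-- Only the generators and relations already born matter, so `u ≤ v` is not required. This gives
-- stabilization as well as monotonicity.
theorem IsCell.mono {u v : Fin r →₀ ℕ} {a b c : Vertex J K}
    (hu : ∀ j, P.deg j ≤ u → P.deg j ≤ v) (hu' : ∀ k, P.relDeg k ≤ u → P.relDeg k ≤ v)
    (h : P.IsCell u a b c) : P.IsCell v a b c := by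
  cases h with
  | spoke h => exact .spoke h
  | gen h => exact .gen (hu _ h)
  | base_src h hl => exact .base_src (hu' _ h) hl
  | base_mid h hl => exact .base_mid (hu' _ h) hl
  | base_tgt h hl => exact .base_tgt (hu' _ h) hl
  | mid_gen h hl => exact .mid_gen (hu' _ h) hl
  | mid_tgt h hl => exact .mid_tgt (hu' _ h) hl
  | mid_path h hl => exact .mid_path (hu' _ h) hl
  | hub_path h hl => exact .hub_path (hu' _ h) hl
  | base_first h => exact .base_first (hu' _ h)
  | base_last h => exact .base_last (hu' _ h)

theorem finite_isVertex [Finite J] [Finite K] : {v | P.IsVertex v}.Finite := by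
  have hN : ∃ N, ∀ k, (P.word k).length ≤ N := by
    obtain ⟨N, hN⟩ := (Set.finite_range fun k => (P.word k).length).bddAbove
    exact ⟨N, fun k => hN ⟨k, rfl⟩⟩
  obtain ⟨N, hN⟩ := hN
  let f : Option (J × Bool) ⊕ (K × Fin (N + 1) × J × Bool) ⊕ (K × Fin (N + 1)) ⊕ K →
    Vertex J K := fun
    | .inl none => base
    | .inl (some (j, b)) => gen j b
    | .inr (.inl (k, t, j, b)) => mid k t j b
    | .inr (.inr (.inl (k, t))) => path k t
    | .inr (.inr (.inr k)) => hub k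
  refine (Set.finite_range f).subset ?_
  intro v hv
  cases hv with
  | base => exact ⟨.inl none, rfl⟩
  | gen j b => exact ⟨.inl (some (j, b)), rfl⟩
  | @mid k t j b h =>
    have := (List.getElem?_eq_some_iff.1 h).1
    exact ⟨.inr (.inl (k, ⟨t, by have := hN k; omega⟩, j, b)), rfl⟩
  | @path k t h => exact ⟨.inr (.inr (.inl (k, ⟨t, by have := hN k; omega⟩))), rfl⟩
  | hub k => exact ⟨.inr (.inr (.inr k)), rfl⟩

theorem exists_upper_bound [Finite J] [Finite K] :
    ∃ u, (∀ j, P.deg j ≤ u) ∧ ∀ k, P.relDeg k ≤ u := by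
  obtain ⟨u, hu⟩ := (Set.finite_range P.deg).bddAbove
  obtain ⟨u', hu'⟩ := (Set.finite_range P.relDeg).bddAbove
  exact ⟨u ⊔ u', fun j => (hu ⟨j, rfl⟩).trans le_sup_left,
    fun k => (hu' ⟨k, rfl⟩).trans le_sup_right⟩

section Complex

variable [LinearOrder (Vertex J K)]

/-- The complex of a presentation in degree `u`. -/
def subcomplex (u : Fin r →₀ ℕ) : PreAbstractSimplicialComplex (Vertex J K) where
  faces := {s | s.Nonempty ∧ ∃ a b c, P.IsCell u a b c ∧ s ⊆ {a, b, c}}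
  isRelLowerSet_faces := by
    rintro s ⟨hs, a, b, c, h, hsub⟩
    exact ⟨hs, fun t ht hne => ⟨hne, a, b, c, h, Finset.Subset.trans ht hsub⟩⟩

theorem subcomplex_le {u v : Fin r →₀ ℕ} (hu : ∀ j, P.deg j ≤ u → P.deg j ≤ v)
    (hu' : ∀ k, P.relDeg k ≤ u → P.relDeg k ≤ v) : P.subcomplex u ≤ P.subcomplex v :=
  fun _ ⟨hs, a, b, c, h, hsub⟩ => ⟨hs, a, b, c, h.mono hu hu', hsub⟩

variable [Finite J] [Finite K]

/-- The multifiltered complex of a presentation. -/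
noncomputable def filteredComplex : FilteredSimplicialComplex r (Vertex J K) where
  complex := P.subcomplex P.exists_upper_bound.choose
  filt u := P.subcomplex u
  mono h := P.subcomplex_le (fun _ hj => hj.trans h) fun _ hk => hk.trans h
  stabilizes := by
    obtain ⟨u', h, h'⟩ := P.exists_upper_bound
    refine ⟨u', fun u hu => le_antisymm ?_ ?_⟩
    · exact P.subcomplex_le (fun j _ => h j) fun k _ => h' k
    · exact P.subcomplex_le (fun _ hj => hj.trans hu) fun _ hk => hk.trans hu
  faces_eq_iUnion := by
    have h := P.exists_upper_bound.choose_spec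
    refine Set.Subset.antisymm (Set.subset_iUnion (fun u => (P.subcomplex u).faces) _)
      (Set.iUnion_subset fun u => ?_)
    exact P.subcomplex_le (fun j _ => h.1 j) fun k _ => h.2 k

theorem isFinite_filteredComplex : P.filteredComplex.IsFinite := by
  refine (P.finite_isVertex.toFinset.powerset.finite_toSet).subset ?_
  rintro s ⟨-, a, b, c, h, hsub⟩
  have := h.isVertex
  simp only [Finset.coe_powerset, Set.mem_preimage, Set.mem_powerset_iff]
  intro x hx
  have := hsub hx
  simp only [Finset.mem_insert, Finset.mem_singleton] at this
  simp only [Set.Finite.coe_toFinset, Set.mem_ofPred_eq]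
  rcases this with rfl | rfl | rfl <;> tauto

end Complex

/-! ### Labels -/

section Labels

variable (R : Type*) [CommRing R] [DecidableEq J]

/-- The potential of the endpoints of a generator. -/
def potential : J → Bool → (J → R)
  | j, true => Pi.single j 1
  | _, false => 0

/-- The vector of a letter. -/
def letter (l : J × Bool) : J → R := potential R l.1 l.2 - potential R l.1 (!l.2)

/-- The sum of the first `t` letters of a relation. -/
def partialSum (k : K) (t : ℕ) : J → R := (((P.word k).take t).map (letter R)).sum

/-- The vector of a relation. -/
def relation (k : K) : J → R := ((P.word k).map (letter R)).sum

/-- One half of the label. -/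
def halfLabel : Vertex J K → Vertex J K → (J → R)
  | gen _ _, gen j b => potential R j b
  | mid _ _ j b, gen j' b' => potential R j' b' - potential R j (!b)
  | mid k t _ _, path _ s => P.partialSum R k s - P.partialSum R k t
  | path _ _, path k s => P.partialSum R k s
  -- The drop to `0` at the end of the path makes the label zero on the edge filled at `base` and
  -- puts the whole relation on the last triangle of the disc.
  | hub k, path _ s => if s < (P.word k).length then P.partialSum R k s else 0
  | _, _ => 0

/-- The label of an oriented edge. -/
def label (a b : Vertex J K) : J → R := P.halfLabel R a b - P.halfLabel R b a

theorem label_symm (a b : Vertex J K) : P.label R b a = -P.label R a b := (neg_sub _ _).symm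

theorem label_self (a : Vertex J K) : P.label R a a = 0 := sub_self _

theorem partialSum_zero (k : K) : P.partialSum R k 0 = 0 := by simp [partialSum]

theorem partialSum_length (k : K) : P.partialSum R k (P.word k).length = P.relation R k := by
  simp [partialSum, relation]

theorem partialSum_succ {k : K} {t : ℕ} {l : J × Bool} (h : (P.word k)[t]? = some l) :
    P.partialSum R k (t + 1) = P.partialSum R k t + letter R l := by
  simp [partialSum, List.take_add_one, h]

/-- The span of the relations of degree at most `u`. -/
def relations (u : Fin r →₀ ℕ) : Submodule R (J → R) :=
  Submodule.span R (P.relation R '' {k | P.relDeg k ≤ u})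

variable {R}

theorem potential_mem_supportedLE {u : Fin r →₀ ℕ} {j : J} (hj : P.deg j ≤ u) (b : Bool) :
    potential R j b ∈ supportedLE P.deg R u := by
  cases b
  · exact zero_mem _
  · intro i hi
    by_cases h : i = j
    · rwa [h]
    · exact absurd (Pi.single_eq_of_ne h _) hi

theorem partialSum_mem_supportedLE {u : Fin r →₀ ℕ} {k : K} (hk : P.relDeg k ≤ u) (t : ℕ) :
    P.partialSum R k t ∈ supportedLE P.deg R u := by
  refine list_sum_mem fun x hx => ?_
  obtain ⟨l, hl, rfl⟩ := List.mem_map.1 hx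
  have := (P.deg_le k l (List.mem_of_mem_take hl)).trans hk
  exact sub_mem (P.potential_mem_supportedLE this _) (P.potential_mem_supportedLE this _)

variable {P} in
-- A cell of a relation exists only once the relation is born, and by `deg_le` its letters are then
-- born too.
theorem IsCell.label_mem_supportedLE {u : Fin r →₀ ℕ} {a b c : Vertex J K} (h : P.IsCell u a b c) :
    P.label R a b ∈ supportedLE P.deg R u ∧ P.label R b c ∈ supportedLE P.deg R u ∧
      P.label R a c ∈ supportedLE P.deg R u := by
  have hdeg {k t j b} (hk : P.relDeg k ≤ u) (hl : (P.word k)[t]? = some (j, b)) (b' : Bool) :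
      potential R j b' ∈ supportedLE P.deg R u :=
    P.potential_mem_supportedLE ((P.deg_le k _ (List.mem_of_getElem? hl)).trans hk) b'
  have hs {k} (hk : P.relDeg k ≤ u) (t : ℕ) := P.partialSum_mem_supportedLE (R := R) hk t
  have h0 := zero_mem (supportedLE P.deg R u)
  cases h with
  | @spoke v h => cases h <;> simp [label, halfLabel]
  | gen h =>
    have := P.potential_mem_supportedLE (R := R) h
    simp [label, halfLabel, this, sub_mem]
  | base_src h hl => simp [label, halfLabel]
  | base_mid h hl => simp [label, halfLabel]
  | base_tgt h hl => simp [label, halfLabel]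
  | mid_gen h hl => simp [label, halfLabel, hdeg h hl, sub_mem]
  | mid_tgt h hl => simp [label, halfLabel, hdeg h hl, hs h, sub_mem]
  | mid_path h hl => simp [label, halfLabel, hs h, sub_mem]
  | hub_path h hl =>
    simp only [label, halfLabel, sub_zero]
    refine ⟨?_, sub_mem (hs h _) (hs h _), ?_⟩ <;> split_ifs <;> simp [hs h]
  | base_first h => simp [label, halfLabel, partialSum_zero]
  | base_last h => simp [label, halfLabel]

variable {P} in
-- The labels form a cochain whose coboundary vanishes on all cells except the last triangle of each
-- disc, where it is the relation.
theorem IsCell.label_sum_mem {u : Fin r →₀ ℕ} {a b c : Vertex J K} (h : P.IsCell u a b c) :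
    P.label R a b + P.label R b c + P.label R c a ∈ P.relations R u := by
  suffices h : P.label R a b + P.label R b c + P.label R c a = 0 ∨ ∃ k, P.relDeg k ≤ u ∧
      P.label R a b + P.label R b c + P.label R c a = P.relation R k by
    rcases h with h | ⟨k, hk, h⟩
    · rw [h]; exact zero_mem _
    · rw [h]; exact Submodule.subset_span ⟨k, hk, rfl⟩
  cases h with
  | @spoke v h => left; cases h <;> simp [label, halfLabel]
  | gen h => left; simp [label, halfLabel]
  | base_src h hl => left; simp [label, halfLabel]
  | base_mid h hl => left; simp [label, halfLabel]
  | base_tgt h hl => left; simp [label, halfLabel]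
  | mid_gen h hl => left; simp [label, halfLabel]
  | mid_tgt h hl => left; simp [label, halfLabel, P.partialSum_succ R hl, letter]
  | mid_path h hl => left; simp [label, halfLabel, P.partialSum_succ R hl, letter]
  | @hub_path k t h hl =>
    rcases lt_or_eq_of_le (Nat.succ_le_of_lt hl) with h' | h'
    · left; simp [label, halfLabel, hl, show t + 1 < (P.word k).length from h']
    · right
      refine ⟨k, h, ?_⟩
      rw [← partialSum_length, ← h']
      simp [label, halfLabel, ← h']
  | base_first h => left; simp [label, halfLabel, partialSum_zero]
  | base_last h => left; simp [label, halfLabel]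

end Labels

end SignedPresentation

/-! ### First homology of the complex of a presentation -/

namespace SignedPresentation

open SimplicialHomology Vertex

variable {r : ℕ} {J K : Type} {P : SignedPresentation r J K} [LinearOrder (Vertex J K)]
  {R : Type*} [CommRing R] {u : Fin r →₀ ℕ}

theorem IsCell.mem_subcomplex {a b c : Vertex J K} (h : P.IsCell u a b c) :
    {a, b, c} ∈ (P.subcomplex u).faces :=
  ⟨⟨a, by simp⟩, a, b, c, h, Finset.Subset.refl _⟩

theorem IsCell.mkQ_eq_zero {a b c : Vertex J K} (h : P.IsCell u a b c) :
    (boundaries R (P.subcomplex u) 1).mkQ (orientedTriangle R a b c) = 0 := by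
  rw [Submodule.mkQ_apply, Submodule.Quotient.mk_eq_zero]
  exact orientedTriangle_mem_boundaries h.mem_subcomplex

theorem spoke_mem {a b c : Vertex J K} (h : P.IsVertex c) (ha : a = base ∨ a = c)
    (hb : b = base ∨ b = c) : {a, b} ∈ (P.subcomplex u).faces := by
  refine ⟨⟨a, by simp⟩, _, _, _, IsCell.spoke h, ?_⟩
  rcases ha with rfl | rfl <;> rcases hb with rfl | rfl <;> simp [Finset.insert_subset_iff]

variable [DecidableEq J]

theorem label_mem_supportedLE {a b : Vertex J K} (h : {a, b} ∈ (P.subcomplex u).faces) :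
    P.label R a b ∈ supportedLE P.deg R u := by
  obtain ⟨-, x, y, z, hc, hsub⟩ := h
  obtain ⟨h1, h2, h3⟩ := hc.label_mem_supportedLE (R := R)
  have hs {a b} (h : P.label R a b ∈ supportedLE P.deg R u) :
      P.label R b a ∈ supportedLE P.deg R u := by
    rw [label_symm]; exact neg_mem h
  have ha := hsub (Finset.mem_insert_self a {b})
  have hb := hsub (Finset.mem_insert_of_mem (Finset.mem_singleton_self b))
  simp only [Finset.mem_insert, Finset.mem_singleton] at ha hb
  rcases ha with rfl | rfl | rfl <;> rcases hb with rfl | rfl | rfl <;>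
    simp only [label_self, zero_mem, h1, h2, h3, hs h1, hs h2, hs h3]

theorem label_sum_mem {a b c : Vertex J K} (hab : a < b) (hbc : b < c)
    (h : {a, b, c} ∈ (P.subcomplex u).faces) :
    P.label R a b + P.label R b c + P.label R c a ∈ P.relations R u := by
  obtain ⟨-, x, y, z, hc, hsub⟩ := h
  have h1 := hc.label_sum_mem (R := R)
  have h2 := neg_mem h1
  have ha := hsub (show a ∈ ({a, b, c} : Finset _) by simp)
  have hb := hsub (show b ∈ ({a, b, c} : Finset _) by simp)
  have hc := hsub (show c ∈ ({a, b, c} : Finset _) by simp)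
  simp only [Finset.mem_insert, Finset.mem_singleton] at ha hb hc
  have hac := hab.trans hbc
  -- Being distinct, `a`, `b`, `c` are a permutation of the vertices of the cell; even permutations
  -- give `h1`, odd ones `h2`.
  rcases ha with rfl | rfl | rfl <;> rcases hb with rfl | rfl | rfl <;>
    rcases hc with rfl | rfl | rfl <;>
    first
    | exact absurd rfl hab.ne
    | exact absurd rfl hbc.ne
    | exact absurd rfl hac.ne
    | exact h1
    | (convert h1 using 1; abel1)
    | (convert h2 using 1; simp only [label]; abel1)

variable (P R) in
/-- The label map of a presentation. -/
noncomputable def chainLabel : (Finset (Vertex J K) →₀ R) →ₗ[R] (J → R) := labelMap (P.label R)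

theorem chainLabel_mem_supportedLE {z : Finset (Vertex J K) →₀ R}
    (hz : z ∈ chains R (P.subcomplex u) 1) : P.chainLabel R z ∈ supportedLE P.deg R u :=
  labelMap_mem_of_mem_chains (fun _ _ _ h => label_mem_supportedLE h) hz

section Determined

variable [Fintype J]

/-- The class modulo boundaries represented by a combination of generators. -/
noncomputable def loopClass (P : SignedPresentation r J K) (R : Type*) [CommRing R]
    (u : Fin r →₀ ℕ) : (J → R) →ₗ[R] (Finset (Vertex J K) →₀ R) ⧸
      boundaries R (P.subcomplex u) 1 :=
  Fintype.linearCombination R fun j =>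
    (boundaries R (P.subcomplex u) 1).mkQ (orientedTriangle R (gen j false) (gen j true) base)

variable (P R u) in
/-- The class of the closed path through `a`, `b` and the base point is determined by the label. -/
def Determined (a b : Vertex J K) : Prop :=
  (boundaries R (P.subcomplex u) 1).mkQ (orientedTriangle R a b base) =
    P.loopClass R u (P.label R a b)

theorem Determined.symm {a b : Vertex J K} (h : P.Determined R u a b) : P.Determined R u b a := by
  rw [Determined, orientedTriangle_swap, label_symm, map_neg, map_neg, h]

theorem determined_self (a : Vertex J K) : P.Determined R u a a := by
  rw [Determined, orientedTriangle_self, label_self, map_zero, map_zero]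

theorem determined_base (a : Vertex J K) : P.Determined R u base a := by
  have : P.label R base a = 0 := by cases a <;> simp [label, halfLabel]
  rw [Determined, orientedTriangle_rotate, orientedTriangle_self, this, map_zero, map_zero]

theorem IsCell.determined_of_base {a b : Vertex J K} (h : P.IsCell u base a b)
    (h' : P.label R a b = 0) : P.Determined R u a b := by
  rw [Determined, h', map_zero, orientedTriangle_rotate, h.mkQ_eq_zero]

/-- By the cocycle identity at `base`, the base loops of the three edges sum to zero modulo
boundaries, as do the labels; two edges therefore settle the third. -/
theorem Determined.trans {a b c : Vertex J K}
    (h : (boundaries R (P.subcomplex u) 1).mkQ (orientedTriangle R a b c) = 0)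
    (hl : P.label R a b + P.label R b c + P.label R c a = 0) (hab : P.Determined R u a b)
    (hbc : P.Determined R u b c) : P.Determined R u a c := by
  rw [← orientedTriangle_cocycle _ _ _ base, map_add, map_add, hab, hbc, ← map_add] at h
  refine Determined.symm ?_
  rw [Determined, eq_neg_of_add_eq_zero_right h, ← map_neg, eq_neg_of_add_eq_zero_right hl]

theorem IsCell.determined {a b c : Vertex J K} (h : P.IsCell u a b c)
    (hl : P.label R a b + P.label R b c + P.label R c a = 0) (hab : P.Determined R u a b)
    (hbc : P.Determined R u b c) : P.Determined R u a c :=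
  .trans h.mkQ_eq_zero hl hab hbc

/-- This is the normalization of `loopClass`. No degree condition appears, because the loop is taken
as a chain whether or not it lies in the complex. -/
theorem determined_gen {j : J} : P.Determined R u (gen j false) (gen j true) := by
  have : P.label R (gen j false) (gen j true) = Pi.single j 1 := by
    simp [label, halfLabel, potential]
  rw [Determined, this, loopClass, Fintype.linearCombination_apply_single, one_smul]

theorem determined_letter (j : J) (b : Bool) : P.Determined R u (gen j (!b)) (gen j b) := by
  cases b
  · exact determined_gen.symm
  · exact determined_gen

section Letter

variable {k : K} {t : ℕ} {j : J} {b : Bool} (h : P.relDeg k ≤ u)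
  (hl : (P.word k)[t]? = some (j, b))
include h hl

theorem determined_src_mid : P.Determined R u (gen j (!b)) (mid k t j b) :=
  (IsCell.base_src h hl).determined_of_base (by simp [label, halfLabel])

theorem determined_mid_path : P.Determined R u (mid k t j b) (path k t) :=
  (IsCell.base_mid h hl).determined_of_base (by simp [label, halfLabel])

theorem determined_tgt_path : P.Determined R u (gen j b) (path k (t + 1)) :=
  (IsCell.base_tgt h hl).determined_of_base (by simp [label, halfLabel])

/-- Determinacy crosses the strip one triangle at a time, from the generator edge through the two
diagonals at `mid` to the path edge; this is the first triangle. -/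
theorem determined_mid_tgt : P.Determined R u (mid k t j b) (gen j b) :=
  (IsCell.mid_gen h hl).determined (by simp [label, halfLabel]) (determined_src_mid h hl).symm
    (determined_letter j b)

theorem determined_mid_path_succ : P.Determined R u (mid k t j b) (path k (t + 1)) :=
  (IsCell.mid_tgt h hl).determined
    (by simp [label, halfLabel, P.partialSum_succ R hl, letter]) (determined_mid_tgt h hl)
    (determined_tgt_path h hl)

end Letter

theorem determined_path {k : K} {t : ℕ} (h : P.relDeg k ≤ u) (hl : t < (P.word k).length) :
    P.Determined R u (path k t) (path k (t + 1)) := by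
  obtain ⟨j, b, hjb⟩ : ∃ j b, (P.word k)[t]? = some (j, b) := ⟨_, _, List.getElem?_eq_getElem hl⟩
  refine .trans (b := mid k t j b) ?_ ?_ (determined_mid_path h hjb).symm
    (determined_mid_path_succ h hjb)
  · rw [orientedTriangle_swap, map_neg, (IsCell.mid_path h hjb).mkQ_eq_zero, neg_zero]
  · simp [label, halfLabel, P.partialSum_succ R hjb]

/-- Go around the disc: the base loop at `path k 0` is filled, and each hub triangle adds the class
of the next letter. `Determined` would not do here, since at the end of the path the label is `0`,
not the partial sum. -/
theorem mkQ_hub_path {k : K} (h : P.relDeg k ≤ u) {t : ℕ} (ht : t ≤ (P.word k).length) :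
    (boundaries R (P.subcomplex u) 1).mkQ (orientedTriangle R (hub k) (path k t) base) =
      P.loopClass R u (P.partialSum R k t) := by
  induction t with
  | zero =>
    rw [orientedTriangle_rotate, (IsCell.base_first h).mkQ_eq_zero, partialSum_zero, map_zero]
  | succ t ih =>
    have h1 := (IsCell.hub_path h ht).mkQ_eq_zero (R := R)
    have h2 : P.label R (path k t) (path k (t + 1)) =
      P.partialSum R k (t + 1) - P.partialSum R k t := rfl
    rw [← orientedTriangle_cocycle _ _ _ base, map_add, map_add, ih (by omega),
      determined_path h ht, ← map_add, h2, add_sub_cancel, orientedTriangle_swap, map_neg,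
      add_neg_eq_zero] at h1
    exact h1.symm

/-- At the end of the path the base loop through the hub represents the whole relation and is also
filled. -/
theorem loopClass_relation {k : K} (h : P.relDeg k ≤ u) :
    P.loopClass R u (P.relation R k) = 0 := by
  rw [← partialSum_length, ← mkQ_hub_path h le_rfl, orientedTriangle_rotate,
    (IsCell.base_last h).mkQ_eq_zero]

theorem loopClass_eq_zero {q : J → R} (hq : q ∈ P.relations R u) : P.loopClass R u q = 0 := by
  have : P.relations R u ≤ LinearMap.ker (P.loopClass R u) := by
    rw [relations, Submodule.span_le]
    rintro _ ⟨k, hk, rfl⟩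
    exact loopClass_relation hk
  exact this hq

theorem determined_hub_path {k : K} (h : P.relDeg k ≤ u) {t : ℕ} (ht : t ≤ (P.word k).length) :
    P.Determined R u (hub k) (path k t) := by
  rw [Determined, mkQ_hub_path h ht]
  rcases ht.lt_or_eq with ht | rfl
  · simp [label, halfLabel, ht]
  · rw [partialSum_length, loopClass_relation h]
    simp [label, halfLabel]

theorem IsCell.determined_edges {a b c : Vertex J K} (h : P.IsCell u a b c) :
    P.Determined R u a b ∧ P.Determined R u b c ∧ P.Determined R u a c := by
  cases h with
  | spoke h => exact ⟨determined_base _, determined_base _, determined_base _⟩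
  | gen h => exact ⟨determined_self _, determined_gen, determined_gen⟩
  | base_src h hl => exact ⟨determined_base _, determined_src_mid h hl, determined_base _⟩
  | base_mid h hl => exact ⟨determined_base _, determined_mid_path h hl, determined_base _⟩
  | base_tgt h hl => exact ⟨determined_base _, determined_tgt_path h hl, determined_base _⟩
  | mid_gen h hl => exact ⟨(determined_src_mid h hl).symm, determined_letter _ _,
      determined_mid_tgt h hl⟩
  | mid_tgt h hl => exact ⟨determined_mid_tgt h hl, determined_tgt_path h hl,
      determined_mid_path_succ h hl⟩
  | mid_path h hl => exact ⟨determined_mid_path h hl,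
      determined_path h (List.getElem?_eq_some_iff.1 hl).1, determined_mid_path_succ h hl⟩
  | hub_path h hl => exact ⟨determined_hub_path h hl.le, determined_path h hl,
      determined_hub_path h hl⟩
  | base_first h => exact ⟨determined_base _, determined_hub_path h (Nat.zero_le _),
      determined_base _⟩
  | base_last h => exact ⟨determined_base _, determined_hub_path h le_rfl, determined_base _⟩

theorem determined_of_mem {a b : Vertex J K} (h : {a, b} ∈ (P.subcomplex u).faces) :
    P.Determined R u a b := by
  obtain ⟨-, x, y, z, hc, hsub⟩ := h
  obtain ⟨h1, h2, h3⟩ := hc.determined_edges (R := R)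
  have ha := hsub (Finset.mem_insert_self a {b})
  have hb := hsub (Finset.mem_insert_of_mem (Finset.mem_singleton_self b))
  simp only [Finset.mem_insert, Finset.mem_singleton] at ha hb
  rcases ha with rfl | rfl | rfl <;> rcases hb with rfl | rfl | rfl <;>
    with_reducible first
    | exact determined_self _
    | assumption
    | (refine Determined.symm ?_; assumption)

theorem mem_boundaries_iff {z : Finset (Vertex J K) →₀ R}
    (hz : z ∈ cycles R (P.subcomplex u) 1) :
    z ∈ boundaries R (P.subcomplex u) 1 ↔ P.chainLabel R z ∈ P.relations R u := by
  constructor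
  · exact labelMap_mem_of_mem_boundaries (P.label_symm R) (P.label_self R)
      fun a b c hab hbc h => label_sum_mem hab hbc h
  · intro h
    rw [← Submodule.Quotient.mk_eq_zero, ← Submodule.mkQ_apply,
      mk_eq_of_mem_cycles base (P.loopClass R u) (fun a b _ h => determined_of_mem h) hz]
    exact loopClass_eq_zero h

theorem exists_chainLabel_eq {q : J → R} (hq : q ∈ supportedLE P.deg R u) :
    ∃ z ∈ cycles R (P.subcomplex u) 1, P.chainLabel R z = q := by
  refine ⟨∑ j, q j • orientedTriangle R (gen j false) (gen j true) base,
    Submodule.sum_mem _ fun j _ => ?_, ?_⟩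
  · by_cases hj : q j = 0
    · rw [hj, zero_smul]
      exact zero_mem _
    · refine Submodule.smul_mem _ _ (orientedTriangle_mem_cycles ?_ ?_ ?_)
      · refine ⟨⟨gen j false, by simp⟩, _, _, _, IsCell.gen (hq j hj), ?_⟩
        simp
      · exact spoke_mem (.gen j true) (.inr rfl) (.inl rfl)
      · exact spoke_mem (.gen j false) (.inl rfl) (.inr rfl)
  · have key (j : J) : P.chainLabel R (orientedTriangle R (gen j false) (gen j true) base) =
        Pi.single j 1 := by
      rw [chainLabel, orientedTriangle, map_add, map_add]
      simp only [labelMap_orientedEdge (P.label_symm R) (P.label_self R)]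
      simp [label, halfLabel, potential]
    simp only [map_sum, map_smul, key]
    ext i
    simp [Pi.single_apply]

end Determined

/-- A presentation of a multigraded module yields a complex whose first homology is this module. -/
theorem isHomologyMarking [Fintype J] [Finite K] {M : Type*} [AddCommGroup M]
    [Module (MvPolynomial (Fin r) R) M] [Module R M] {𝓜 : (Fin r →₀ ℕ) → AddSubgroup M}
    (π : (Fin r →₀ ℕ) → (J → R) →ₗ[R] M)
    (mem : ∀ u, ∀ q ∈ supportedLE P.deg R u, π u q ∈ 𝓜 u)
    (surj : ∀ u, ∀ m ∈ 𝓜 u, ∃ q ∈ supportedLE P.deg R u, π u q = m)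
    (ker : ∀ u, ∀ q ∈ supportedLE P.deg R u, π u q = 0 ↔ q ∈ P.relations R u)
    (shift : ∀ u v, u ≤ v → ∀ q ∈ supportedLE P.deg R u,
      π v q = MvPolynomial.monomial (v - u) (1 : R) • π u q) :
    IsHomologyMarking P.filteredComplex 1 𝓜 (fun u => π u ∘ₗ P.chainLabel R) where
  mem u z hz := mem u _ (chainLabel_mem_supportedLE hz.1)
  surj u m hm := by
    obtain ⟨q, hq, rfl⟩ := surj u m hm
    obtain ⟨z, hz, rfl⟩ := exists_chainLabel_eq hq
    exact ⟨z, hz, rfl⟩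
  eq_zero_iff u z hz :=
    (ker u _ (chainLabel_mem_supportedLE hz.1)).trans (mem_boundaries_iff hz).symm
  shift u v huv z hz := shift u v huv _ (chainLabel_mem_supportedLE hz.1)

end SignedPresentation

/-! ### Presentations of multigraded modules -/

namespace IsMultigraded

open MvPolynomial

variable {r : ℕ} {R : Type*} [CommRing R] {M : Type*} [AddCommGroup M]
  [Module (MvPolynomial (Fin r) R) M] {𝓜 : (Fin r →₀ ℕ) → AddSubgroup M}

/-- Homogeneous elements span, and every spanning set of a finitely generated module contains a
finite one. -/
theorem exists_generators (h : IsMultigraded R 𝓜) [Module.Finite (MvPolynomial (Fin r) R) M] :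
    ∃ (m : ℕ) (g : Fin m → M) (d : Fin m → (Fin r →₀ ℕ)), (∀ j, g j ∈ 𝓜 (d j)) ∧
      Submodule.span (MvPolynomial (Fin r) R) (Set.range g) = ⊤ := by
  have htop : Submodule.span (MvPolynomial (Fin r) R) (⋃ u, (𝓜 u : Set M)) = ⊤ := by
    rw [eq_top_iff]
    intro x _
    obtain ⟨y, rfl⟩ := h.isInternal.surjective x
    induction y using DirectSum.induction_on with
    | zero => rw [map_zero]; exact zero_mem _
    | of u y =>
      rw [DirectSum.coeAddMonoidHom_of]
      exact Submodule.subset_span (Set.mem_iUnion.2 ⟨u, y.2⟩)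
    | add y y' hy hy' => rw [map_add]; exact add_mem (hy trivial) (hy' trivial)
  obtain ⟨s, hs, hspan⟩ := (Submodule.fg_span_iff_fg_span_finset_subset _).1
    (htop ▸ Module.Finite.fg_top)
  have hd (j : Fin s.card) : ∃ u, (s.equivFin.symm j : M) ∈ 𝓜 u :=
    Set.mem_iUnion.1 (hs (s.equivFin.symm j).2)
  choose d hd using hd
  refine ⟨s.card, fun j => s.equivFin.symm j, d, hd, ?_⟩
  rw [← htop, hspan]
  congr 1
  ext x
  constructor
  · rintro ⟨j, rfl⟩
    exact (s.equivFin.symm j).2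
  · intro hx
    exact ⟨s.equivFin ⟨x, hx⟩, by simp⟩

theorem eq_of_sum_eq (h : DirectSum.IsInternal 𝓜) {s : Finset (Fin r →₀ ℕ)}
    {f : (Fin r →₀ ℕ) → M} (hf : ∀ v, f v ∈ 𝓜 v) (hs : ∀ v, v ∉ s → f v = 0)
    {u : Fin r →₀ ℕ} {m : M} (hm : m ∈ 𝓜 u) (hsum : ∑ v ∈ s, f v = m) : f u = m := by
  have h1 : DirectSum.of (fun v => 𝓜 v) u ⟨m, hm⟩ =
      ∑ v ∈ s, DirectSum.of (fun v => 𝓜 v) v ⟨f v, hf v⟩ := by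
    refine h.injective ?_
    rw [map_sum]
    simp only [DirectSum.coeAddMonoidHom_of, hsum]
  have h2 := congrArg (fun x : ⨁ v, 𝓜 v => (x u : M)) h1
  simp only [DirectSum.of_eq_same, DirectSum.sum_apply, AddSubgroup.val_finsetSum] at h2
  rw [h2]
  by_cases hu : u ∈ s
  · rw [Finset.sum_eq_single u, DirectSum.of_eq_same]
    · intro v _ hv
      rw [DirectSum.of_eq_of_ne _ _ _ hv.symm]
      rfl
    · exact fun h => absurd hu h
  · rw [hs u hu, Finset.sum_eq_zero]
    intro v hv
    rw [DirectSum.of_eq_of_ne _ _ _ (by rintro rfl; exact hu hv)]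
    rfl

end IsMultigraded

namespace HomogeneousGenerators

open MvPolynomial

variable {r : ℕ} {R : Type*} [CommRing R] {M : Type*} [AddCommGroup M]
  [Module (MvPolynomial (Fin r) R) M] [Module R M]
  {J : Type} (d : J → (Fin r →₀ ℕ)) (g : J → M)

variable {d} in
theorem supportedLE_mono {u v : Fin r →₀ ℕ} (h : u ≤ v) : supportedLE d R u ≤ supportedLE d R v :=
  fun _ hq j hj => (hq j hj).trans h

variable [Fintype J]

/-- The map `Rᴶ → M` onto the part of degree `u`, sending the `j`-th basis vector to
`x^(u - d j) • g j`. -/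
noncomputable def toModule (u : Fin r →₀ ℕ) : (J → R) →ₗ[R] M :=
  Fintype.linearCombination R fun j => monomial (u - d j) (1 : R) • g j

/-- The relations in degree `u`. -/
noncomputable def relations (u : Fin r →₀ ℕ) : Submodule R (J → R) :=
  supportedLE d R u ⊓ LinearMap.ker (toModule d g u)

variable {d g}

theorem toModule_apply (u : Fin r →₀ ℕ) (q : J → R) :
    toModule d g u q = ∑ j, q j • monomial (u - d j) (1 : R) • g j := rfl

variable [IsScalarTower R (MvPolynomial (Fin r) R) M]

/-- Subtraction of exponents is truncated; `(v - u) + (u - d j) = v - d j` holds because `d j ≤ u`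
wherever `q j ≠ 0`. -/
theorem toModule_shift {u v : Fin r →₀ ℕ} (h : u ≤ v) {q : J → R} (hq : q ∈ supportedLE d R u) :
    toModule d g v q = monomial (v - u) (1 : R) • toModule d g u q := by
  rw [toModule_apply, toModule_apply, Finset.smul_sum]
  refine Finset.sum_congr rfl fun j _ => ?_
  by_cases hj : q j = 0
  · simp [hj]
  · rw [← smul_assoc (q j), ← smul_assoc (q j), smul_smul, mul_smul_comm, monomial_mul, one_mul,
      tsub_add_tsub_cancel h (hq j hj)]

theorem relations_mono {u v : Fin r →₀ ℕ} (h : u ≤ v) :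
    relations (R := R) d g u ≤ relations d g v := fun q hq =>
  ⟨supportedLE_mono h hq.1, by
    have h2 : toModule d g u q = 0 := hq.2
    change toModule d g v q = 0
    rw [toModule_shift h hq.1, h2, smul_zero]⟩

variable {𝓜 : (Fin r →₀ ℕ) → AddSubgroup M}

theorem toModule_mem (h : IsMultigraded R 𝓜) (hg : ∀ j, g j ∈ 𝓜 (d j)) (u : Fin r →₀ ℕ)
    {q : J → R} (hq : q ∈ supportedLE d R u) : toModule d g u q ∈ 𝓜 u := by
  rw [toModule_apply]
  refine sum_mem fun j _ => ?_
  by_cases hj : q j = 0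
  · rw [hj, zero_smul]
    exact zero_mem _
  · rw [← smul_assoc, smul_monomial]
    have := h.smul_mem (u - d j) (d j) (q j • 1) (g j) (hg j)
    rwa [tsub_add_cancel_of_le (hq j hj)] at this

/-- The sum of the images is stable under monomials, hence under all polynomials, and contains the
generators. -/
theorem iSup_map_toModule (hspan : Submodule.span (MvPolynomial (Fin r) R) (Set.range g) = ⊤) :
    ⨆ u, (supportedLE d R u).map (toModule d g u) = ⊤ := by
  classical
  set N := ⨆ u, (supportedLE d R u).map (toModule d g u) with hN
  have hle (u) : (supportedLE d R u).map (toModule d g u) ≤ N :=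
    le_iSup (fun u => (supportedLE d R u).map (toModule d g u)) u
  have hmon (a : Fin r →₀ ℕ) (c : R) (x : M) (hx : x ∈ N) : monomial a c • x ∈ N := by
    have hx' : x ∈ ⨆ u, (supportedLE d R u).map (toModule d g u) := hx
    clear hx
    induction hx' using Submodule.iSup_induction' with
    | mem u x hxu =>
      obtain ⟨q, hq, rfl⟩ := hxu
      have : monomial a c • toModule d g u q = c • toModule d g (u + a) q := by
        rw [toModule_shift le_self_add hq, add_tsub_cancel_left, ← smul_assoc, smul_monomial,
          smul_eq_mul, mul_one]
      rw [this]
      exact Submodule.smul_mem _ _ (hle _ ⟨q, supportedLE_mono le_self_add hq, rfl⟩)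
    | zero => rw [smul_zero]; exact zero_mem _
    | add x y _ _ h1 h2 => rw [smul_add]; exact add_mem h1 h2
  have hsmul (f : MvPolynomial (Fin r) R) (x : M) (hx : x ∈ N) : f • x ∈ N := by
    induction f using MvPolynomial.induction_on' with
    | monomial a c => exact hmon a c x hx
    | add p q hp hq => rw [add_smul]; exact add_mem hp hq
  rw [eq_top_iff]
  intro x _
  have hx : x ∈ Submodule.span (MvPolynomial (Fin r) R) (Set.range g) :=
    hspan ▸ Submodule.mem_top
  induction hx using Submodule.span_induction with
  | mem x hx =>
    obtain ⟨j, rfl⟩ := hx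
    refine hle (d j) ⟨Pi.single j 1, fun i hi => ?_, ?_⟩
    · by_cases h : i = j
      · rw [h]
      · exact absurd (Pi.single_eq_of_ne h _) hi
    · rw [toModule, Fintype.linearCombination_apply_single, one_smul, tsub_self]
      exact one_smul _ _
  | zero => exact zero_mem _
  | add x y _ _ hx hy => exact add_mem (hx trivial) (hy trivial)
  | smul f x _ hx => exact hsmul f x (hx trivial)

/-- Write `m` as a sum of images from various degrees; by uniqueness of homogeneous components the
degree `u` term alone is `m`. -/
theorem exists_toModule_eq (h : IsMultigraded R 𝓜) (hg : ∀ j, g j ∈ 𝓜 (d j))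
    (hspan : Submodule.span (MvPolynomial (Fin r) R) (Set.range g) = ⊤) {u : Fin r →₀ ℕ} {m : M}
    (hm : m ∈ 𝓜 u) : ∃ q ∈ supportedLE d R u, toModule d g u q = m := by
  have hm' : m ∈ ⨆ u, (supportedLE d R u).map (toModule d g u) :=
    iSup_map_toModule hspan ▸ Submodule.mem_top
  obtain ⟨f, hf, hsum⟩ := (Submodule.mem_iSup_iff_exists_finsupp _ _).1 hm'
  have hf' (v) : f v ∈ 𝓜 v := by
    obtain ⟨q, hq, hqv⟩ := hf v
    exact hqv ▸ toModule_mem h hg v hq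
  have := IsMultigraded.eq_of_sum_eq h.isInternal hf' (s := f.support)
    (fun v hv => Finsupp.notMem_support_iff.1 hv) hm hsum
  obtain ⟨q, hq, hqu⟩ := hf u
  exact ⟨q, hq, hqu.trans this⟩

end HomogeneousGenerators

/-! ### Finite generation of the relations -/

section MonotoneFamilies

open MvPolynomial

variable {r : ℕ} {R : Type*} [CommRing R] [IsNoetherianRing R] {J : Type} [Finite J]

/-- A monotone family of submodules of `Rᴶ` indexed by `ℕʳ` is generated by finitely many vectors
in finitely many degrees. -/
theorem exists_finset_span_eq (N : (Fin r →₀ ℕ) → Submodule R (J → R)) (hN : Monotone N) :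
    ∃ s : Finset ((Fin r →₀ ℕ) × (J → R)), (∀ x ∈ s, x.2 ∈ N x.1) ∧
      ∀ u, N u ≤ Submodule.span R {a | ∃ e ≤ u, (e, a) ∈ s} := by
  classical
  let co (u : Fin r →₀ ℕ) (f : J → MvPolynomial (Fin r) R) : J → R := fun j => coeff u (f j)
  have co_smul (u) (p : MvPolynomial (Fin r) R) (f) : co u (p • f) =
      ∑ x ∈ Finset.HasAntidiagonal.antidiagonal u, coeff x.1 p • co x.2 f := by
    ext j
    simp [co, coeff_mul, Finset.sum_apply]
  -- `T` is the graded submodule with `N u` in degree `u`; monotonicity makes it stable under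
  -- multiplication, and it is finitely generated by Hilbert's basis theorem.
  let T : Submodule (MvPolynomial (Fin r) R) (J → MvPolynomial (Fin r) R) :=
    { carrier := {f | ∀ u, co u f ∈ N u}
      zero_mem' := fun u => by
        have : co u 0 = 0 := by ext j; simp [co]
        rw [this]; exact zero_mem _
      add_mem' := fun {f f'} hf hf' u => by
        have : co u (f + f') = co u f + co u f' := by ext j; simp [co]
        rw [this]; exact add_mem (hf u) (hf' u)
      smul_mem' := fun p f hf u => by
        rw [co_smul]
        refine sum_mem fun x hx => Submodule.smul_mem _ _ (hN ?_ (hf x.2))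
        rw [← Finset.HasAntidiagonal.mem_antidiagonal.1 hx]
        exact le_add_self }
  obtain ⟨G, hG⟩ := IsNoetherian.noetherian T
  have := Fintype.ofFinite J
  -- The generators in `G` need not be homogeneous, so all their homogeneous components are
  -- recorded, with their degrees.
  let s : Finset ((Fin r →₀ ℕ) × (J → R)) :=
    G.biUnion fun f => (Finset.univ.biUnion fun j => (f j).support).image fun e => (e, co e f)
  refine ⟨s, ?_, fun u q hq => ?_⟩
  · intro x hx
    simp only [s, Finset.mem_biUnion, Finset.mem_image] at hx
    obtain ⟨f, hf, e, -, rfl⟩ := hx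
    exact (hG ▸ Submodule.subset_span hf : f ∈ T) e
  · have hqT : (fun j => monomial u (q j)) ∈ T := fun v => by
      by_cases hv : u = v
      · subst hv
        have : co u (fun j => monomial u (q j)) = q := by ext j; simp [co]
        rwa [this]
      · have : co v (fun j => monomial u (q j)) = 0 := by ext j; simp [co, coeff_monomial, hv]
        rw [this]; exact zero_mem _
    have key : ∀ f ∈ T, ∀ u, co u f ∈ Submodule.span R {a | ∃ e ≤ u, (e, a) ∈ s} := by
      intro f hf
      rw [← hG] at hf
      induction hf using Submodule.span_induction with
      | mem f hf =>
        intro u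
        by_cases h0 : co u f = 0
        · rw [h0]; exact zero_mem _
        · obtain ⟨j, hj⟩ := Function.ne_iff.1 h0
          refine Submodule.subset_span ⟨u, le_rfl, ?_⟩
          simp only [s, Finset.mem_biUnion, Finset.mem_image]
          exact ⟨f, hf, u, ⟨j, Finset.mem_univ _, mem_support_iff.2 hj⟩, rfl⟩
      | zero =>
        intro u
        have : co u 0 = 0 := by ext j; simp [co]
        rw [this]; exact zero_mem _
      | add f f' _ _ h h' =>
        intro u
        have : co u (f + f') = co u f + co u f' := by ext j; simp [co]
        rw [this]; exact add_mem (h u) (h' u)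
      | smul p f _ h =>
        intro u
        rw [co_smul]
        refine sum_mem fun x hx => Submodule.smul_mem _ _ (Submodule.span_mono ?_ (h x.2))
        rintro a ⟨e, he, hs⟩
        refine ⟨e, he.trans ?_, hs⟩
        rw [← Finset.HasAntidiagonal.mem_antidiagonal.1 hx]
        exact le_add_self
    have := key _ hqT u
    have hco : co u (fun j => monomial u (q j)) = q := by ext j; simp [co]
    rwa [hco] at this

end MonotoneFamilies

/-! ### Relations as words with integer multiplicities -/

section IntegerMultiples

/-- For a prime field or the integers, every vector is integral up to a unit. -/
theorem exists_unit_smul_eq_intCast {R : Type*} [CommRing R]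
    (hR : (∃ p : ℕ, p.Prime ∧ Nonempty (R ≃+* ZMod p)) ∨ Nonempty (R ≃+* ℚ) ∨
      Nonempty (R ≃+* ℤ)) {J : Type} [Finite J] (a : J → R) :
    ∃ (c : Rˣ) (z : J → ℤ), (∀ j, z j ≠ 0 → a j ≠ 0) ∧ ∀ j, (z j : R) = c • a j := by
  classical
  suffices h : ∃ (c : Rˣ) (z : J → ℤ), ∀ j, (z j : R) = c • a j by
    obtain ⟨c, z, hz⟩ := h
    -- A lift of `0` from `ZMod p` may be a nonzero multiple of `p`; resetting it keeps generators
    -- of too large a degree out of the word.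
    refine ⟨c, fun j => if a j = 0 then 0 else z j, fun j hj h => hj (if_pos h), fun j => ?_⟩
    by_cases h : a j = 0
    · simp [h]
    · simp [h, hz]
  rcases hR with ⟨p, -, ⟨e⟩⟩ | ⟨⟨e⟩⟩ | ⟨⟨e⟩⟩
  · choose z hz using fun j => ZMod.intCast_surjective (e (a j))
    refine ⟨1, z, fun j => e.injective ?_⟩
    rw [map_intCast, hz, one_smul]
  · obtain ⟨b, hb⟩ := IsLocalization.exist_integer_multiples_of_finite (nonZeroDivisors ℤ)
      (fun j => e (a j))
    choose z hz using hb
    have hb0 : ((b : ℤ) : ℚ) ≠ 0 := Int.cast_ne_zero.2 (nonZeroDivisors.coe_ne_zero b)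
    refine ⟨Units.map e.symm.toMonoidHom (Units.mk0 _ hb0), z, fun j => e.injective ?_⟩
    rw [map_intCast, Units.smul_def, smul_eq_mul, map_mul]
    have := hz j
    simp only [eq_intCast, zsmul_eq_mul] at this
    simp [this]
  · refine ⟨1, fun j => e (a j), fun j => e.injective ?_⟩
    rw [map_intCast, one_smul, Int.cast_id]

theorem isNoetherianRing_of_ringEquiv_primeField {R : Type*} [CommRing R]
    (hR : (∃ p : ℕ, p.Prime ∧ Nonempty (R ≃+* ZMod p)) ∨ Nonempty (R ≃+* ℚ) ∨
      Nonempty (R ≃+* ℤ)) : IsNoetherianRing R := by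
  rcases hR with ⟨p, hp, ⟨e⟩⟩ | ⟨⟨e⟩⟩ | ⟨⟨e⟩⟩
  · have := Fact.mk hp
    exact isNoetherianRing_of_ringEquiv _ e.symm
  · exact isNoetherianRing_of_ringEquiv _ e.symm
  · exact isNoetherianRing_of_ringEquiv _ e.symm

end IntegerMultiples

namespace SignedPresentation

theorem exists_word {J : Type} [Fintype J] [DecidableEq J] (R : Type*) [CommRing R] (z : J → ℤ) :
    ∃ w : List (J × Bool), (∀ l ∈ w, z l.1 ≠ 0) ∧
      (w.map (letter R)).sum = fun j => (z j : R) := by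
  let f (j : J) : List (J × Bool) := List.replicate (z j).natAbs (j, decide (0 ≤ z j))
  refine ⟨Finset.univ.toList.flatMap f, fun l hl => ?_, ?_⟩
  · obtain ⟨j, -, hj⟩ := List.mem_flatMap.1 hl
    obtain ⟨h, rfl⟩ := List.mem_replicate.1 hj
    exact fun h' => h (by simpa using h')
  · have key (j : J) : ((f j).map (letter R)).sum = Pi.single j (z j : R) := by
      ext i
      rcases le_or_gt 0 (z j) with h | h
      · obtain ⟨n, hn⟩ := Int.eq_ofNat_of_zero_le h
        by_cases hi : i = j
        · subst hi; simp [f, letter, potential, hn]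
        · simp [f, letter, potential, hn, hi]
      · obtain ⟨n, hn⟩ := Int.exists_eq_neg_ofNat h.le
        have hn0 : n ≠ 0 := by omega
        by_cases hi : i = j
        · subst hi; simp [f, letter, potential, hn, hn0]
        · simp [f, letter, potential, hn, hi, hn0]
    rw [List.map_flatMap, List.flatMap, List.sum_flatten, List.map_map]
    have : (List.sum ∘ fun a => List.map (letter R) (f a)) = fun j => Pi.single j (z j : R) :=
      funext key
    rw [this, Finset.sum_map_toList]
    exact Finset.univ_sum_single _

end SignedPresentation

-- The complex is built from homogeneous generators and finitely many relations, each rescaled by a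
-- unit to become a word; rescaling does not change the spans.
open SignedPresentation HomogeneousGenerators in
theorem exists_isHomologyMarking_one {R : Type*} [CommRing R]
    (hR : (∃ p : ℕ, p.Prime ∧ Nonempty (R ≃+* ZMod p)) ∨ Nonempty (R ≃+* ℚ) ∨
      Nonempty (R ≃+* ℤ))
    {r : ℕ} {M : Type*} [AddCommGroup M] [Module (MvPolynomial (Fin r) R) M] [Module R M]
    [IsScalarTower R (MvPolynomial (Fin r) R) M] [Module.Finite (MvPolynomial (Fin r) R) M]
    {𝓜 : (Fin r →₀ ℕ) → AddSubgroup M} (h𝓜 : IsMultigraded R 𝓜) :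
    ∃ (V : Type) (_ : LinearOrder V) (X : FilteredSimplicialComplex r V)
      (φ : (Fin r →₀ ℕ) → (Finset V →₀ R) →ₗ[R] M), X.IsFinite ∧ IsHomologyMarking X 1 𝓜 φ := by
  have := isNoetherianRing_of_ringEquiv_primeField hR
  obtain ⟨m, g, d, hg, hspan⟩ := h𝓜.exists_generators
  obtain ⟨s, hs, hspan'⟩ := exists_finset_span_eq (HomogeneousGenerators.relations (R := R) d g)
    fun _ _ h => relations_mono h
  choose c z hz hcz using fun a : Fin m → R => exists_unit_smul_eq_intCast hR a
  choose w hw hwz using fun z : Fin m → ℤ => exists_word R z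
  let rel (k : Fin s.card) : (Fin r →₀ ℕ) × (Fin m → R) := s.equivFin.symm k
  have hrel (k) : (rel k).2 ∈ HomogeneousGenerators.relations d g (rel k).1 :=
    hs _ (s.equivFin.symm k).2
  let P : SignedPresentation r (Fin m) (Fin s.card) :=
    { deg := d
      relDeg := fun k => (rel k).1
      word := fun k => w (z (rel k).2)
      deg_le := fun k l hl => (hrel k).1 _ (hz _ _ (hw _ l hl)) }
  have hP (k) : P.relation R k = c (rel k).2 • (rel k).2 := by
    rw [relation, hwz]
    exact funext (hcz _)
  have hrels (u) : P.relations R u = HomogeneousGenerators.relations d g u := by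
    apply le_antisymm
    · rw [SignedPresentation.relations, Submodule.span_le]
      rintro _ ⟨k, hk, rfl⟩
      rw [hP]
      exact Submodule.smul_mem _ _ (relations_mono hk (hrel k))
    · refine (hspan' u).trans (Submodule.span_le.2 ?_)
      rintro a ⟨e, he, ha⟩
      obtain ⟨k, hk⟩ : ∃ k, rel k = (e, a) := ⟨s.equivFin ⟨_, ha⟩, by simp [rel]⟩
      have h1 : P.relation R k ∈ P.relations R u :=
        Submodule.subset_span ⟨k, (congrArg Prod.fst hk).trans_le he, rfl⟩
      rw [hP, hk] at h1
      have := Submodule.smul_mem (P.relations R u) ((c a)⁻¹ : Rˣ).val h1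
      rwa [← Units.smul_def, inv_smul_smul] at this
  -- Any linear order will do, since oriented edges and labels do not depend on it up to the signs
  -- already accounted for.
  let _ : LinearOrder (Vertex (Fin m) (Fin s.card)) := IsWellOrder.linearOrder WellOrderingRel
  refine ⟨Vertex (Fin m) (Fin s.card), inferInstance, P.filteredComplex, _,
    P.isFinite_filteredComplex, isHomologyMarking (toModule d g) ?_ ?_ ?_ ?_⟩
  · exact fun u q hq => toModule_mem h𝓜 hg u hq
  · exact fun u m hm => exists_toModule_eq h𝓜 hg hspan hm
  · intro u q hq
    rw [hrels]
    exact ⟨fun h => ⟨hq, h⟩, fun h => h.2⟩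
  · exact fun u v huv q hq => toModule_shift huv hq

theorem theorem2p11 {R : Type*} [CommRing R]
    (hR : (∃ p : ℕ, p.Prime ∧ Nonempty (R ≃+* ZMod p)) ∨ Nonempty (R ≃+* ℚ) ∨
      Nonempty (R ≃+* ℤ))
    (r : ℕ) {M : Type*} [AddCommGroup M] [Module (MvPolynomial (Fin r) R) M]
    (hfin : Module.Finite (MvPolynomial (Fin r) R) M)
    (𝓜 : (Fin r →₀ ℕ) → AddSubgroup M) (hgr : IsMultigraded R 𝓜)
    (i : ℕ) (hi : 0 < i) :
    ∃ (V : Type) (_ : LinearOrder V) (X : FilteredSimplicialComplex r V), X.IsFinite ∧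
      ∃ e : M ≃ₗ[MvPolynomial (Fin r) R] (X.homology R i).Total,
        ∀ (u : Fin r →₀ ℕ) (m : M), m ∈ 𝓜 u ↔ e m ∈ (X.homology R i).piece u := by
  let _ : Module R M := Module.compHom M (algebraMap R (MvPolynomial (Fin r) R))
  have : IsScalarTower R (MvPolynomial (Fin r) R) M :=
    ⟨fun c f x => by rw [Algebra.smul_def, mul_smul]; rfl⟩
  -- The induction on `i` carries a marking, a statement about chains that passes directly to
  -- suspensions, rather than the isomorphism.
  suffices h : ∃ (V : Type) (_ : LinearOrder V) (X : FilteredSimplicialComplex r V)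
      (φ : (Fin r →₀ ℕ) → (Finset V →₀ R) →ₗ[R] M), X.IsFinite ∧ IsHomologyMarking X i 𝓜 φ by
    obtain ⟨V, hV, X, φ, hX, hφ⟩ := h
    exact ⟨V, hV, X, hX, hφ.exists_linearEquiv hgr.isInternal⟩
  induction i, hi using Nat.le_induction with
  | base => exact exists_isHomologyMarking_one hR hgr
  | succ n hn ih =>
    obtain ⟨V, hV, X, φ, hX, hφ⟩ := ih
    exact ⟨Bool ⊕ₗ V, inferInstance, Suspension.filteredSuspension X, _,
      Suspension.finite_suspension hX, Suspension.isHomologyMarking hn hφ⟩
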